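/- Let $K\ge 1$ and $n\ge 1$ be integers. For $\alpha=0,\dots,K$ let $c^\alpha=\frac{1-\cos(\pi\alpha/K)}{2}$ be the Chebyshev–Lobatto points on $[0,1]$ and let $P^\alpha$ be the corresponding Lagrange basis polynomials (of degree $K$, with $P^\alpha(c^\beta)=\delta_{\alpha\beta}$). Let $$\Lambda_K=\max_{x\in[0,1]}\sum_{\alpha=0}^K|P^\alpha(x)|,\qquad E_K=\max_{x,y\in[0,1]}\Big|e^{-2\pi i xy}-\sum_{\alpha=0}^K e^{-2\pi i c^\alpha y}P^\alpha(x)\Big|$$ be the Lebesgue constant of $(K+1)$-point Chebyshev–Lobatto interpolation and its worst-case error over the functions $f_y(x)=e^{-2\pi i xy}$, $y\in[0,1]$. Let $F$ be the $2^n\times 2^n$ DFT matrix viewed as a tensor in bits: for $\sigma,\tau\in\{0,1\}^n$, $F(\sigma,\tau)=e^{-2\pi i st/2^n}$ with $s=\sum_{k=1}^n2^{n-k}\sigma_k$ and $t=\sum_{k=1}^n2^{k-1}\tau_k$. For $\sigma,\tau\in\{0,1\}$ and $0\le\alpha,\beta\le K$ let $$A^{\alpha\beta}(\sigma,\tau)=P^\alpha\Big(\frac{\sigma+c^\beta}{2}\Big)e^{-\pi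 i(\sigma+c^\beta)\tau},\qquad A_{\mathrm L}^\beta=\sum_{\alpha=0}^K A^{\alpha\beta},\qquad A_{\mathrm R}^\alpha=A^{\alpha0}.$$ For $n\ge2$ let $F_{\mathrm{MPO}}$ be the $n$-site, rank-$(K+1)$ MPO with leftmost core $A_{\mathrm L}$, all $n-2$ internal cores equal to $A$, and rightmost core $A_{\mathrm R}$: $$F_{\mathrm{MPO}}(\sigma,\tau)=\sum_{\alpha_1,\dots,\alpha_{n-1}=0}^{K}A_{\mathrm L}^{\alpha_1}(\sigma_1,\tau_1)\Big(\prod_{k=2}^{n-1}A^{\alpha_{k-1}\alpha_k}(\sigma_k,\tau_k)\Big)A_{\mathrm R}^{\alpha_{n-1}}(\sigma_n,\tau_n);$$ for $n=1$ let $F_{\mathrm{MPO}}=A_{\mathrm L}^0$. Let $\|T\|_\infty$ denote the largest absolute value of an entry of a tensor $T$. Then: 1. $A_{\mathrm L}^\beta(\sigma,\tau)=e^{-\pi i(\sigma+c^\beta)\tau}$ and $A_{\mathrm R}^\alpha(\sigma,\tau)=P^\alpha(\sigma/2)\,e^{-\pi i\sigma\tau}$. 2. If $K\ge2$, then $\Lambda_K>1$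 and $$\|F_{\mathrm{MPO}}-F\|_\infty\le\frac{\Lambda_K^{n-1}-1}{\Lambda_K-1}\,E_K\le(n-1)\,\Lambda_K^{n-2}\,E_K .$$ If $K=1$, then $\Lambda_K=1$ and $\|F_{\mathrm{MPO}}-F\|_\infty\le(n-1)E_K$. (For $n=1$ the factor $(n-1)\Lambda_K^{n-2}$ is $0$.) 3. $\Lambda_K\le1+\frac2\pi\log(K+1)$, and if $K\ge2$, then $$E_K\le\frac{4\left(\frac\pi2\right)^{K+1}e^K K^{-K}}{K-\frac\pi2}.$$ -/

import Mathlib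

noncomputable section

namespace QFT

/-- The (matrix of the) discrete Fourier transform of size `N`: entry `(s, t)` is
`exp (-2 π i s t / N)`. -/
def dftEntry (N s t : ℕ) : ℂ :=
  Complex.exp (-(2 * Real.pi * Complex.I * s * t / N))

/-- The row index `s = ∑_{k=1}^n 2^(n-k) σ_k`; sites are numbered from `0` here, so that
site `k + 1` of the informal formula is `k : Fin n`. -/
def rowIndex {n : ℕ} (σ : Fin n → Fin 2) : ℕ :=
  ∑ k : Fin n, 2 ^ (n - 1 - (k : ℕ)) * (σ k : ℕ)

/-- The column index `t = ∑_{k=1}^n 2^(k-1) τ_k` (opposite bit ordering). -/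
def colIndex {n : ℕ} (τ : Fin n → Fin 2) : ℕ :=
  ∑ k : Fin n, 2 ^ (k : ℕ) * (τ k : ℕ)

/-- The DFT matrix of size `2 ^ n` viewed as a tensor in the bits `σ, τ`. -/
def dftTensor (n : ℕ) (σ τ : Fin n → Fin 2) : ℂ :=
  dftEntry (2 ^ n) (rowIndex σ) (colIndex τ)

/-- Chebyshev–Lobatto grid points on `[0, 1]`. -/
def node (K : ℕ) (α : Fin (K + 1)) : ℝ :=
  (1 - Real.cos (Real.pi * (α : ℕ) / K)) / 2

/-- The Lagrange basis polynomial `P^α` of the Chebyshev–Lobatto grid. -/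
def cardinal (K : ℕ) (α : Fin (K + 1)) : Polynomial ℝ :=
  Lagrange.basis Finset.univ (node K) α

/-- Chebyshev–Lobatto interpolant of `f`, evaluated at `x`. -/
def interp (K : ℕ) (f : ℝ → ℂ) (x : ℝ) : ℂ :=
  ∑ α : Fin (K + 1), f (node K α) * (((cardinal K α).eval x : ℝ) : ℂ)

/-- The function `f_y (x) = exp (-2 π i x y)`. -/
def planeWave (y x : ℝ) : ℂ :=
  Complex.exp (-(2 * Real.pi * Complex.I * x * y))

/-- The Lebesgue constant `Λ_K = max_{x ∈ [0,1]} ∑_α |P^α(x)|`. -/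
def lebesgueConst (K : ℕ) : ℝ :=
  ⨆ x : Set.Icc (0 : ℝ) 1, ∑ α : Fin (K + 1), |(cardinal K α).eval (x : ℝ)|

/-- The worst-case interpolation error `E_K = max_{y ∈ [0,1]} max_{x ∈ [0,1]}` of
`|f_y(x) - ∑_α f_y(c^α) P^α(x)|`. -/
def interpError (K : ℕ) : ℝ :=
  ⨆ p : Set.Icc (0 : ℝ) 1 × Set.Icc (0 : ℝ) 1,
    ‖planeWave p.1 (p.2 : ℝ) - interp K (planeWave p.1) (p.2 : ℝ)‖

/-- The internal core `A^{αβ}(σ, τ) = P^α((σ + c^β)/2) exp(-π i (σ + c^β) τ)`. -/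
def core (K : ℕ) (α β : Fin (K + 1)) (σ τ : Fin 2) : ℂ :=
  (((cardinal K α).eval ((((σ : ℕ) : ℝ) + node K β) / 2) : ℝ) : ℂ) *
    Complex.exp (-(Real.pi * Complex.I * (((σ : ℕ) : ℂ) + (node K β : ℂ)) * ((τ : ℕ) : ℂ)))

/-- The leftmost core `A_L^β = ∑_α A^{αβ}`. -/
def leftCore (K : ℕ) (β : Fin (K + 1)) (σ τ : Fin 2) : ℂ :=
  ∑ α : Fin (K + 1), core K α β σ τ

/-- The rightmost core `A_R^α = A^{α0}`. -/
def rightCore (K : ℕ) (α : Fin (K + 1)) (σ τ : Fin 2) : ℂ :=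
  core K α 0 σ τ

/-- The tensor of an MPO on `m + 2` sites with bond dimension `r`, leftmost core `L`,
the same internal core `A` on all `m` internal sites, and rightmost core `R`:
the sum over the `m + 1` bond indices of the product of the cores. -/
def mpoTensor {r : ℕ} (m : ℕ) (L : Fin r → Fin 2 → Fin 2 → ℂ)
    (A : Fin r → Fin r → Fin 2 → Fin 2 → ℂ) (R : Fin r → Fin 2 → Fin 2 → ℂ)
    (σ τ : Fin (m + 2) → Fin 2) : ℂ :=
  ∑ α : Fin (m + 1) → Fin r,
    L (α 0) (σ 0) (τ 0) *
      (∏ k : Fin m, A (α k.castSucc) (α k.succ) (σ k.castSucc.succ) (τ k.castSucc.succ)) *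
      R (α (Fin.last m)) (σ (Fin.last (m + 1))) (τ (Fin.last (m + 1)))

/-- The `n`-site, rank-`(K + 1)` MPO approximating the DFT. With a single site there is no
bond, and the MPO is the left core with its bond index closed at `0`, which is
`∑_α A_R^α`; the value at `n = 0` is a placeholder. -/
def dftMPO (K : ℕ) : (n : ℕ) → (Fin n → Fin 2) → (Fin n → Fin 2) → ℂ
  | 0 => fun _ _ => 1
  | 1 => fun σ τ => leftCore K 0 (σ 0) (τ 0)
  | m + 2 => mpoTensor m (leftCore K) (core K) (rightCore K)

/-- Infinity norm of a tensor: the largest magnitude of an entry. -/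
def tensorNorm {n : ℕ} (T : (Fin n → Fin 2) → (Fin n → Fin 2) → ℂ) : ℝ :=
  Finset.univ.sup' Finset.univ_nonempty
    fun p : (Fin n → Fin 2) × (Fin n → Fin 2) => ‖T p.1 p.2‖

end QFT

end

namespace QFT

open Polynomial Real

/-! ### Chebyshev–Lobatto nodes and cardinal polynomials -/

/-! MPO bound. Write f_y for the plane wave. Since f_y(x) f_τ(x) = f_{y'}(σ) f_{y'}(c^β) for x = (σ
+ c^β)/2 and y' = (y + τ)/2, contracting node samples of f_y with a core gives, up to interpolation
error, a unimodular constant times samples of f_{y'}, and y' stays in [0,1]. Each contraction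
multiplies the inherited error by at most Λ_K and adds E_K (`norm_sum_mul_core_sub_le`). The left
core is exact because ∑ P^α = 1; the remaining n - 1 contractions give the geometric sum in
`norm_dftMPO_sub_le`. The accumulated phases are the DFT entry modulo 2πi (`foldedWave_eq`).

Interpolation error. The nodal polynomial is at most 4^{-K} on [0,1], so the classical remainder
formula, applied to a rotated real part, gives 4(π/2)^{K+1}/(K+1)!.

Lebesgue constant. With x = (1 - cos θ)/2, partial fractions bound ∑|P^α(x)| by |sin Kθ|/(2K) times
a sum of |cot| over 2K equispaced translates (`sum_nodeCot`). Paired symmetrically, each damped pair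
is largest midway between nodes (`cos_nat_mul_mul_cot_add_cot_le`). This leaves an explicit mean of
cotangents, estimated by cot x ≤ 1/x - x/3 and a harmonic sum (`cotMean_le`). -/

theorem node_eq_chebyshev (K : ℕ) (α : Fin (K + 1)) :
    node K α = (1 - Chebyshev.node K α) / 2 := by
  rw [node, Chebyshev.node, mul_comm π]

theorem node_strictMono (K : ℕ) : StrictMono (node K) := by
  intro a b hab
  have := Chebyshev.node_lt (n := K) (Nat.lt_succ_iff.mp b.2) (Fin.lt_def.mp hab)
  rw [node_eq_chebyshev, node_eq_chebyshev]
  linarith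

theorem chebyshev_node_injective (K : ℕ) :
    Function.Injective fun α : Fin (K + 1) => Chebyshev.node K α := by
  intro a b hab
  apply (node_strictMono K).injective
  simp only at hab
  rw [node_eq_chebyshev, node_eq_chebyshev, hab]

theorem node_mem_Icc (K : ℕ) (α : Fin (K + 1)) : node K α ∈ Set.Icc (0 : ℝ) 1 := by
  have := Chebyshev.node_mem_Icc (n := K) (i := α)
  rw [node_eq_chebyshev]
  constructor <;> linarith [this.1, this.2]

theorem node_zero (K : ℕ) : node K 0 = 0 := by simp [node]

theorem cardinal_eval_node (K : ℕ) (α β : Fin (K + 1)) :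
    (cardinal K α).eval (node K β) = if α = β then 1 else 0 := by
  split_ifs with h
  · subst h
    exact Lagrange.eval_basis_self (node_strictMono K).injective.injOn (Finset.mem_univ _)
  · exact Lagrange.eval_basis_of_ne h (Finset.mem_univ _)

theorem sum_cardinal_eval (K : ℕ) (x : ℝ) :
    ∑ α : Fin (K + 1), (cardinal K α).eval x = 1 := by
  have := Lagrange.sum_basis (s := Finset.univ) (v := node K)
    (node_strictMono K).injective.injOn Finset.univ_nonempty
  have h := congrArg (Polynomial.eval x) this
  simpa [eval_finsetSum, cardinal] using h

/-- The monic polynomial vanishing at the Chebyshev extrema `cos (k π / (m + 1))`. -/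
theorem nodal_chebyshev_node (m : ℕ) :
    Lagrange.nodal Finset.univ (fun α : Fin (m + 1 + 1) => Chebyshev.node (m + 1) α) =
      C ((2 : ℝ) ^ m)⁻¹ * ((X ^ 2 - 1) * Chebyshev.U ℝ m) := by
  have hq : (X ^ 2 - 1 : ℝ[X]).Monic := by
    simpa using monic_X_pow_sub_C (1 : ℝ) two_ne_zero
  have hqd : (X ^ 2 - 1 : ℝ[X]).natDegree = 2 := by
    simpa using natDegree_X_pow_sub_C (n := 2) (r := (1 : ℝ))
  have h2 : (2 : ℝ) ^ m ≠ 0 := by positivity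
  have hlead : (C ((2 : ℝ) ^ m)⁻¹ * ((X ^ 2 - 1) * Chebyshev.U ℝ m)).Monic := by
    rw [Monic, leadingCoeff_mul, leadingCoeff_mul, hq.leadingCoeff, leadingCoeff_C,
      Chebyshev.leadingCoeff_U_natCast]
    field_simp
  have hdeg : (C ((2 : ℝ) ^ m)⁻¹ * ((X ^ 2 - 1) * Chebyshev.U ℝ m)).natDegree = m + 1 + 1 := by
    have hU : Chebyshev.U ℝ (m : ℤ) ≠ 0 := by
      intro h
      have := Chebyshev.leadingCoeff_U_natCast ℝ m
      rw [h] at this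
      simp at this
      exact h2 this.symm
    rw [natDegree_C_mul (inv_ne_zero h2), natDegree_mul hq.ne_zero hU, hqd,
      Chebyshev.natDegree_U_natCast]
    ring
  -- Two monic polynomials of degree m + 2 that agree at m + 2 points are equal; at the nodes both
  -- vanish, by sin θ · U_m(cos θ) = sin((m+1)θ).
  apply Polynomial.eq_of_degree_sub_lt_of_eval_index_eq (s := Finset.univ)
    (v := fun α : Fin (m + 1 + 1) => Chebyshev.node (m + 1) α)
    (chebyshev_node_injective _).injOn
  · have h := degree_sub_lt_left (p := Lagrange.nodal Finset.univ
      (fun α : Fin (m + 1 + 1) => Chebyshev.node (m + 1) α))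
      (q := C ((2 : ℝ) ^ m)⁻¹ * ((X ^ 2 - 1) * Chebyshev.U ℝ m)) ?_ Lagrange.nodal_ne_zero ?_
    · rwa [Lagrange.degree_nodal] at h
    · rw [Lagrange.degree_nodal, degree_eq_natDegree hlead.ne_zero, hdeg]
      simp
    · rw [Lagrange.nodal_monic.leadingCoeff, hlead.leadingCoeff]
  · intro i _
    rw [Lagrange.eval_nodal_at_node (v := fun α : Fin (m + 1 + 1) => Chebyshev.node (m + 1) α)
      (Finset.mem_univ i)]
    have h := Chebyshev.U_real_cos ((i : ℕ) * π / (m + 1 : ℕ)) m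
    have hs : sin (((m : ℤ) + 1 : ℝ) * ((i : ℕ) * π / (m + 1 : ℕ))) = 0 := by
      rw [show ((m : ℤ) + 1 : ℝ) * ((i : ℕ) * π / (m + 1 : ℕ)) = (i : ℕ) * π by
        push_cast; field_simp]
      exact sin_nat_mul_pi _
    rw [hs] at h
    simp only [eval_mul, eval_C, eval_sub, eval_pow, eval_X, eval_one, Chebyshev.node]
    have h3 := sin_sq_add_cos_sq ((i : ℕ) * π / (m + 1 : ℕ))
    rw [show cos ((i : ℕ) * π / (m + 1 : ℕ)) ^ 2 - 1 =
      -(sin ((i : ℕ) * π / (m + 1 : ℕ)) * sin ((i : ℕ) * π / (m + 1 : ℕ))) by linarith]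
    linear_combination ((2 : ℝ) ^ m)⁻¹ * sin ((i : ℕ) * π / (m + 1 : ℕ)) * h

theorem eval_nodal_chebyshev_cos (m : ℕ) (θ : ℝ) :
    (Lagrange.nodal Finset.univ (fun α : Fin (m + 1 + 1) => Chebyshev.node (m + 1) α)).eval
      (cos θ) = -((2 : ℝ) ^ m)⁻¹ * (sin θ * sin ((m + 1 : ℕ) * θ)) := by
  rw [nodal_chebyshev_node]
  have h := Chebyshev.U_real_cos θ m
  have h3 := sin_sq_add_cos_sq θ
  simp only [eval_mul, eval_C, eval_sub, eval_pow, eval_X, eval_one]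
  rw [show cos θ ^ 2 - 1 = -(sin θ * sin θ) by linarith]
  push_cast at h ⊢
  linear_combination -((2 : ℝ) ^ m)⁻¹ * sin θ * h

/-- The factor by which the barycentric weight of a node is reduced: `2` at the end points. -/
def endFactor (K j : ℕ) : ℝ := if j = 0 ∨ j = K then 2 else 1

theorem endFactor_pos (K j : ℕ) : 0 < endFactor K j := by
  rw [endFactor]; split_ifs <;> norm_num

/-- The derivative of (X² - 1)U_m is (m+1)T_{m+1} + X U_m. At a node the first term is (-1)^j (m+1);
the second vanishes at interior nodes and equals the first at the end points, whence the doubling.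
-/
theorem eval_derivative_nodal_chebyshev (m : ℕ) (j : Fin (m + 1 + 1)) :
    (derivative (Lagrange.nodal Finset.univ
      (fun α : Fin (m + 1 + 1) => Chebyshev.node (m + 1) α))).eval
      (Chebyshev.node (m + 1) j) =
      ((2 : ℝ) ^ m)⁻¹ * ((-1) ^ (j : ℕ) * ((m + 1 : ℕ) * endFactor (m + 1) j)) := by
  rw [nodal_chebyshev_node]
  have hj : (j : ℕ) ≤ m + 1 := Nat.lt_succ_iff.mp j.2
  set w := Chebyshev.node (m + 1) j with hw
  have hT : (Chebyshev.T ℝ ((m + 1 : ℕ) : ℤ)).eval w = (-1) ^ (j : ℕ) :=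
    Chebyshev.eval_T_real_node (by simpa using hj)
  have hd := congrArg (eval w) (Chebyshev.add_one_mul_T_eq_poly_in_U (R := ℝ) (m : ℤ))
  simp only [eval_mul, eval_add, eval_sub, eval_pow, eval_X, eval_one, eval_intCast] at hd
  push_cast at hT hd
  rw [hT] at hd
  have hU : w * (Chebyshev.U ℝ (m : ℤ)).eval w =
      (-1) ^ (j : ℕ) * ((m + 1 : ℕ) * (endFactor (m + 1) j - 1)) := by
    rcases Nat.eq_zero_or_pos (j : ℕ) with h0 | h0
    · rw [hw, h0, Chebyshev.node_eq_one, Chebyshev.U_eval_one]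
      simp [endFactor]
      ring
    rcases eq_or_lt_of_le hj with h1 | h1
    · rw [hw, h1, Chebyshev.node_eq_neg_one (Nat.succ_ne_zero m), Chebyshev.U_eval_neg_one]
      simp [endFactor, Int.negOnePow_def]
      ring
    · have h := Chebyshev.U_real_cos ((j : ℕ) * π / (m + 1 : ℕ)) m
      have hs : sin (((m : ℤ) + 1 : ℝ) * ((j : ℕ) * π / (m + 1 : ℕ))) = 0 := by
        rw [show ((m : ℤ) + 1 : ℝ) * ((j : ℕ) * π / (m + 1 : ℕ)) = (j : ℕ) * π by
          push_cast; field_simp]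
        exact sin_nat_mul_pi _
      have hpos : 0 < sin ((j : ℕ) * π / (m + 1 : ℕ)) := by
        apply sin_pos_of_pos_of_lt_pi
        · have : (0 : ℝ) < (j : ℕ) := by exact_mod_cast h0
          positivity
        · rw [div_lt_iff₀ (by positivity), mul_comm]
          gcongr
      rw [hs] at h
      have hU0 : (Chebyshev.U ℝ (m : ℤ)).eval w = 0 :=
        (mul_eq_zero.mp h).resolve_right hpos.ne'
      rw [hU0, endFactor, if_neg (by omega)]
      ring
  simp only [derivative_mul, derivative_C, derivative_sub, derivative_X_pow, derivative_one,
    eval_mul, eval_add, eval_sub, eval_pow, eval_X, eval_one, eval_C, eval_zero]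
  push_cast at hU ⊢
  linear_combination ((2 : ℝ) ^ m)⁻¹ * (hU - hd)

theorem cardinal_eval_eq (K : ℕ) (α : Fin (K + 1)) (w : ℝ) :
    (cardinal K α).eval ((1 - w) / 2) =
      (Lagrange.basis Finset.univ (fun α : Fin (K + 1) => Chebyshev.node K α) α).eval w := by
  rw [cardinal, Lagrange.basis, Lagrange.basis, eval_prod, eval_prod]
  refine Finset.prod_congr rfl fun j _ => ?_
  simp only [Lagrange.basisDivisor, eval_mul, eval_C, eval_sub, eval_X, node_eq_chebyshev]
  rw [show (1 - Chebyshev.node K α) / 2 - (1 - Chebyshev.node K j) / 2 =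
    (Chebyshev.node K α - Chebyshev.node K j) * (-(1 / 2)) by ring,
    show (1 - w) / 2 - (1 - Chebyshev.node K j) / 2 =
    (w - Chebyshev.node K j) * (-(1 / 2)) by ring, mul_inv]
  ring

/-- Barycentric form: nodal polynomial over its derivative at the node times the distance to the
node; the powers of 2 cancel. -/
theorem abs_cardinal_eval {K : ℕ} (hK : 1 ≤ K) (α : Fin (K + 1)) {θ : ℝ}
    (h : cos θ ≠ Chebyshev.node K α) :
    |(cardinal K α).eval ((1 - cos θ) / 2)| =
      |sin θ * sin (K * θ)| / (K * endFactor K α * |cos θ - Chebyshev.node K α|) := by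
  obtain ⟨m, rfl⟩ : ∃ m, K = m + 1 := ⟨K - 1, by omega⟩
  rw [cardinal_eval_eq, Lagrange.eval_basis_not_at_node (Finset.mem_univ α) h,
    Lagrange.nodalWeight_eq_eval_derivative_nodal (Finset.mem_univ α),
    eval_derivative_nodal_chebyshev, eval_nodal_chebyshev_cos]
  have h2 : (0 : ℝ) < 2 ^ m := by positivity
  have h3 : (0 : ℝ) < (m + 1 : ℕ) := by positivity
  have h4 := endFactor_pos (m + 1) α
  simp only [abs_mul, abs_neg, abs_inv, abs_pow, abs_one, one_pow, abs_of_pos h2, abs_of_pos h3,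
    abs_of_pos h4]
  have h5 : |cos θ - Chebyshev.node (m + 1) α| ≠ 0 := abs_ne_zero.mpr (sub_ne_zero.mpr h)
  field_simp

/-- On `[0, 1]` the product of the distances to the nodes is at most `4 ^ (-K)`. -/
theorem abs_nodal_eval_le {K : ℕ} (hK : 1 ≤ K) {x : ℝ} (hx : x ∈ Set.Icc (0 : ℝ) 1) :
    |(Lagrange.nodal Finset.univ (node K)).eval x| ≤ (4 ^ K)⁻¹ := by
  obtain ⟨m, rfl⟩ : ∃ m, K = m + 1 := ⟨K - 1, by omega⟩
  have hc : cos (arccos (1 - 2 * x)) = 1 - 2 * x :=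
    cos_arccos (by linarith [hx.2]) (by linarith [hx.1])
  have h := eval_nodal_chebyshev_cos m (arccos (1 - 2 * x))
  rw [hc, Lagrange.eval_nodal] at h
  have h1 : (Lagrange.nodal Finset.univ (node (m + 1))).eval x =
      (-(1 / 2)) ^ (m + 2) * ∏ i : Fin (m + 1 + 1), (1 - 2 * x - Chebyshev.node (m + 1) i) := by
    rw [Lagrange.eval_nodal]
    have : (-(1 / 2) : ℝ) ^ (m + 2) = ∏ i : Fin (m + 1 + 1), (-(1 / 2)) := by simp
    rw [this, ← Finset.prod_mul_distrib]
    refine Finset.prod_congr rfl fun j _ => ?_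
    rw [node_eq_chebyshev]
    ring
  rw [h1, h, abs_mul, abs_mul, abs_neg, abs_mul, abs_pow, abs_neg, abs_inv,
    abs_of_pos (show (0 : ℝ) < 2 ^ m by positivity), abs_of_pos (show (0 : ℝ) < 1 / 2 by norm_num)]
  -- The factor 2^m is the leading coefficient of U_m; 2^(m+2) comes from rescaling [-1,1] to [0,1].
  have h4 : (4 : ℝ) ^ (m + 1) = 2 ^ m * 2 ^ (m + 2) := by
    rw [show (4 : ℝ) = 2 ^ 2 by norm_num, ← pow_mul, ← pow_add]
    congr 1
    ring
  rw [h4, mul_inv, one_div, inv_pow, mul_comm (2 ^ m : ℝ)⁻¹]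
  have h5 : |sin (arccos (1 - 2 * x))| * |sin ((m + 1 : ℕ) * arccos (1 - 2 * x))| ≤ 1 := by
    calc _ ≤ (1 : ℝ) * 1 := by gcongr <;> exact abs_sin_le_one _
      _ = 1 := one_mul 1
  have h6 : (0 : ℝ) ≤ (2 ^ m)⁻¹ * (2 ^ (m + 2))⁻¹ := by positivity
  calc _ = ((2 ^ m)⁻¹ * (2 ^ (m + 2))⁻¹) * (|sin (arccos (1 - 2 * x))| *
      |sin ((m + 1 : ℕ) * arccos (1 - 2 * x))|) := by ring
    _ ≤ ((2 ^ m)⁻¹ * (2 ^ (m + 2))⁻¹) * 1 := by gcongr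
    _ = _ := by ring

end QFT

namespace QFT

open Polynomial Real

/-! ### The interpolation error -/

/-- Iterated Rolle theorem, for a function given with its successive derivatives. -/
theorem exists_eq_zero_of_strictMono_zeros (n : ℕ) :
    ∀ (F : ℕ → ℝ → ℝ), (∀ k x, HasDerivAt (F k) (F (k + 1) x) x) →
      ∀ x : Fin (n + 1) → ℝ, StrictMono x → (∀ i, F 0 (x i) = 0) → ∃ ξ, F n ξ = 0 := by
  induction n with
  | zero => exact fun F _ x _ h => ⟨x 0, h 0⟩
  | succ n ih =>
    intro F hF x hx h0
    have hr : ∀ i : Fin (n + 1), ∃ y ∈ Set.Ioo (x i.castSucc) (x i.succ), F 1 y = 0 := fun i =>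
      exists_hasDerivAt_eq_zero (hx Fin.castSucc_lt_succ)
        (fun z _ => (hF 0 z).continuousAt.continuousWithinAt) (by rw [h0, h0])
        fun z _ => hF 0 z
    choose y hy hy0 using hr
    refine ih (fun k => F (k + 1)) (fun k z => hF (k + 1) z) y ?_ hy0
    intro i j hij
    have : x i.succ ≤ x j.castSucc := hx.monotone (by
      rw [Fin.le_def]; simp only [Fin.val_succ, Fin.val_castSucc]; exact Fin.lt_def.mp hij)
    exact (hy i).2.trans_le (this.trans (hy j).1.le)

theorem exists_eq_zero_of_card_zeros {n : ℕ} {F : ℕ → ℝ → ℝ}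
    (hF : ∀ k x, HasDerivAt (F k) (F (k + 1) x) x) {Z : Finset ℝ} (hZ : Z.card = n + 1)
    (h0 : ∀ z ∈ Z, F 0 z = 0) : ∃ ξ, F n ξ = 0 :=
  exists_eq_zero_of_strictMono_zeros n F hF (Z.orderEmbOfFin hZ) (Z.orderEmbOfFin hZ).strictMono
    fun i => h0 _ (Z.orderEmbOfFin_mem hZ i)

theorem iterate_derivative_of_monic {p : ℝ[X]} (hp : p.Monic) :
    derivative^[p.natDegree] p = C (p.natDegree.factorial : ℝ) := by
  have h : derivative^[p.natDegree] (p - X ^ p.natDegree) = 0 := by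
    by_cases h0 : p.natDegree = 0
    · rw [hp.natDegree_eq_zero.mp h0]; simp
    · apply iterate_derivative_eq_zero_of_degree_lt
      rw [← degree_eq_natDegree hp.ne_zero]
      exact degree_sub_lt_left (by rw [degree_X_pow, degree_eq_natDegree hp.ne_zero]) hp.ne_zero
        (by rw [hp.leadingCoeff, (monic_X_pow _).leadingCoeff])
  rw [iterate_derivative_sub, sub_eq_zero] at h
  rw [h, iterate_derivative_X_pow_eq_C_mul]
  simp [Nat.descFactorial_self]

theorem hasDerivAt_iterate_derivative (p : ℝ[X]) (k : ℕ) (x : ℝ) :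
    HasDerivAt (fun t => (derivative^[k] p).eval t) ((derivative^[k + 1] p).eval x) x := by
  rw [Function.iterate_succ_apply']
  exact (derivative^[k] p).hasDerivAt x

/-- The Lagrange interpolation error, for a function given with its successive derivatives. -/
theorem abs_sub_interpolation_le {K : ℕ} {F : ℕ → ℝ → ℝ}
    (hF : ∀ k x, HasDerivAt (F k) (F (k + 1) x) x) {M : ℝ} (hM : ∀ x, |F (K + 1) x| ≤ M)
    (v : Fin (K + 1) → ℝ) (hv : Function.Injective v) (x : ℝ) :
    |F 0 x - ∑ α, F 0 (v α) * (Lagrange.basis Finset.univ v α).eval x| ≤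
      M / (K + 1).factorial * |(Lagrange.nodal Finset.univ v).eval x| := by
  set p : ℝ[X] := Lagrange.interpolate Finset.univ v fun α => F 0 (v α) with hp
  set N := Lagrange.nodal Finset.univ v with hN
  have hpx : ∀ t, p.eval t = ∑ α, F 0 (v α) * (Lagrange.basis Finset.univ v α).eval t := by
    intro t
    rw [hp, Lagrange.interpolate_apply, eval_finsetSum]
    simp
  have hpv : ∀ α, p.eval (v α) = F 0 (v α) := fun α =>
    Lagrange.eval_interpolate_at_node _ hv.injOn (Finset.mem_univ α)
  have hM0 : 0 ≤ M := (abs_nonneg _).trans (hM 0)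
  rw [← hpx]
  by_cases hx : ∃ α, x = v α
  · obtain ⟨α, rfl⟩ := hx
    rw [hpv, sub_self, abs_zero]
    positivity
  have hNx : N.eval x ≠ 0 := by
    rw [hN, Lagrange.eval_nodal]
    exact Finset.prod_ne_zero_iff.mpr fun i _ => sub_ne_zero.mpr fun h => hx ⟨i, h⟩
  -- With this R, the function F 0 - p - R·N vanishes at x as well as at the K + 1 nodes, so its
  -- derivative of order K + 1 has a zero.
  set R := (F 0 x - p.eval x) / N.eval x with hR
  have hNd : N.natDegree = K + 1 := by simp [hN]
  obtain ⟨ξ, hξ⟩ := exists_eq_zero_of_card_zeros (n := K + 1)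
    (F := fun k t => F k t - (derivative^[k] p).eval t - R * (derivative^[k] N).eval t)
    (fun k t => ((hF k t).sub (hasDerivAt_iterate_derivative p k t)).sub
      ((hasDerivAt_iterate_derivative N k t).const_mul R))
    (Z := insert x (Finset.univ.image v))
    (by
      rw [Finset.card_insert_of_notMem (by simpa [eq_comm] using hx),
        Finset.card_image_of_injective _ hv]
      simp)
    (by
      intro z hz
      rcases Finset.mem_insert.mp hz with rfl | hz
      · simp only [Function.iterate_zero, id]
        rw [hR, div_mul_cancel₀ _ hNx, sub_self]
      · obtain ⟨α, -, rfl⟩ := Finset.mem_image.mp hz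
        simp only [Function.iterate_zero, id]
        rw [hpv, hN, Lagrange.eval_nodal_at_node (Finset.mem_univ α)]
        ring)
  have hp0 : derivative^[K + 1] p = 0 := by
    apply iterate_derivative_eq_zero_of_degree_lt
    have h := Lagrange.degree_interpolate_lt (s := Finset.univ) (fun α => F 0 (v α)) hv.injOn
    rwa [Finset.card_univ, Fintype.card_fin] at h
  have hN0 : derivative^[K + 1] N = C ((K + 1).factorial : ℝ) := by
    have := iterate_derivative_of_monic (p := N) Lagrange.nodal_monic
    rwa [hNd] at this
  have hf : (0 : ℝ) < (K + 1).factorial := by positivity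
  simp only [hp0, hN0, eval_zero, eval_C, sub_zero] at hξ
  have hRle : |R| ≤ M / (K + 1).factorial := by
    rw [le_div_iff₀ hf, ← abs_of_pos hf, ← abs_mul, ← sub_eq_zero.mp hξ]
    exact hM ξ
  calc |F 0 x - p.eval x| = |R| * |N.eval x| := by
        rw [← abs_mul, hR, div_mul_cancel₀ _ hNx]
    _ ≤ _ := by gcongr

theorem planeWave_eq (y x : ℝ) :
    planeWave y x = Complex.exp (((-(2 * π * y) * x : ℝ) : ℂ) * Complex.I) := by
  rw [planeWave]
  congr 1
  push_cast
  ring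

/-- The remainder formula needs a real function. Rotating by minus the argument of the error at x
makes that error real and nonnegative, and the rotated plane wave has real part cos(a t + φ), whose
derivatives only shift the phase and gain powers of a. -/
theorem norm_sub_interp_le {K : ℕ} (hK : 1 ≤ K) {y x : ℝ} (hy : y ∈ Set.Icc (0 : ℝ) 1)
    (hx : x ∈ Set.Icc (0 : ℝ) 1) :
    ‖planeWave y x - interp K (planeWave y) x‖ ≤
      (2 * π) ^ (K + 1) / (K + 1).factorial * (4 ^ K)⁻¹ := by
  set z := planeWave y x - interp K (planeWave y) x with hz
  set φ := -Complex.arg z with hφ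
  set a := -(2 * π * y) with ha
  have hre : ∀ t : ℝ, (Complex.exp ((φ : ℂ) * Complex.I) * planeWave y t).re =
      cos (a * t + φ) := by
    intro t
    rw [planeWave_eq, ← Complex.exp_add, ← add_mul, ← Complex.ofReal_add,
      Complex.exp_ofReal_mul_I_re, add_comm]
  have hnorm : ‖z‖ = (Complex.exp ((φ : ℂ) * Complex.I) * z).re := by
    have h : Complex.exp ((φ : ℂ) * Complex.I) * z = (‖z‖ : ℂ) := by
      conv_lhs => rw [← Complex.norm_mul_exp_arg_mul_I z]
      rw [mul_left_comm, ← Complex.exp_add, hφ]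
      simp
    rw [h, Complex.ofReal_re]
  have hF : ∀ (k : ℕ) (t : ℝ), HasDerivAt (fun t => a ^ k * cos (a * t + φ + k * (π / 2)))
      (a ^ (k + 1) * cos (a * t + φ + (k + 1 : ℕ) * (π / 2))) t := by
    intro k t
    have h1 : HasDerivAt (fun t : ℝ => a * t + φ + k * (π / 2)) a t := by
      simpa using (((hasDerivAt_id t).const_mul a).add_const φ).add_const (k * (π / 2))
    convert! (h1.cos).const_mul (a ^ k) using 1
    rw [show a * t + φ + (k + 1 : ℕ) * (π / 2) = a * t + φ + k * (π / 2) + π / 2 by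
      push_cast; ring, cos_add_pi_div_two]
    ring
  have hab : |a| ≤ 2 * π := by
    rw [ha, abs_neg, abs_of_nonneg (by have := hy.1; positivity)]
    have := hy.2
    nlinarith [pi_pos]
  have hM : ∀ t : ℝ, |a ^ (K + 1) * cos (a * t + φ + (K + 1 : ℕ) * (π / 2))| ≤
      (2 * π) ^ (K + 1) := by
    intro t
    rw [abs_mul, abs_pow]
    calc _ ≤ (2 * π) ^ (K + 1) * 1 := by
          gcongr
          exact abs_cos_le_one _
      _ = _ := mul_one _
  have h := abs_sub_interpolation_le (K := K)
    (F := fun k t => a ^ k * cos (a * t + φ + k * (π / 2))) hF hM (node K)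
    (node_strictMono K).injective x
  simp only [pow_zero, one_mul, Nat.cast_zero, zero_mul, add_zero] at h
  have hsum : (Complex.exp ((φ : ℂ) * Complex.I) * z).re = cos (a * x + φ) -
      ∑ α, cos (a * node K α + φ) * (Lagrange.basis Finset.univ (node K) α).eval x := by
    rw [hz, mul_sub, Complex.sub_re, hre, interp, Finset.mul_sum, Complex.re_sum]
    congr 1
    refine Finset.sum_congr rfl fun α _ => ?_
    rw [← mul_assoc, Complex.re_mul_ofReal, hre, cardinal]
  rw [hnorm, hsum]
  refine (le_abs_self _).trans (h.trans ?_)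
  gcongr
  exact abs_nodal_eval_le hK hx

theorem bddAbove_interpError {K : ℕ} (hK : 1 ≤ K) :
    BddAbove (Set.range fun p : Set.Icc (0 : ℝ) 1 × Set.Icc (0 : ℝ) 1 =>
      ‖planeWave p.1 (p.2 : ℝ) - interp K (planeWave p.1) (p.2 : ℝ)‖) := by
  refine ⟨(2 * π) ^ (K + 1) / (K + 1).factorial * (4 ^ K)⁻¹, ?_⟩
  rintro _ ⟨p, rfl⟩
  exact norm_sub_interp_le hK p.1.2 p.2.2

theorem norm_sub_interp_le_interpError {K : ℕ} (hK : 1 ≤ K) {y x : ℝ}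
    (hy : y ∈ Set.Icc (0 : ℝ) 1) (hx : x ∈ Set.Icc (0 : ℝ) 1) :
    ‖planeWave y x - interp K (planeWave y) x‖ ≤ interpError K :=
  le_ciSup (bddAbove_interpError hK)
    ((⟨y, hy⟩, ⟨x, hx⟩) : Set.Icc (0 : ℝ) 1 × Set.Icc (0 : ℝ) 1)

theorem interpError_nonneg (K : ℕ) : 0 ≤ interpError K :=
  Real.iSup_nonneg fun _ => norm_nonneg _

theorem interpError_le_factorial {K : ℕ} (hK : 1 ≤ K) :
    interpError K ≤ 4 * (π / 2) ^ (K + 1) / (K + 1).factorial := by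
  refine ciSup_le fun p => (norm_sub_interp_le hK p.1.2 p.2.2).trans_eq ?_
  rw [show 2 * π = 4 * (π / 2) by ring, mul_pow, pow_succ (4 : ℝ)]
  field_simp

theorem interpError_le {K : ℕ} (hK : 2 ≤ K) :
    interpError K ≤ 4 * (π / 2) ^ (K + 1) * exp K * (K : ℝ) ^ (-(K : ℤ)) / ((K : ℝ) - π / 2) := by
  refine (interpError_le_factorial (by omega)).trans ?_
  have hK' : (2 : ℝ) ≤ K := by exact_mod_cast hK
  have hpos : 0 < (K : ℝ) - π / 2 := by linarith [pi_lt_d2]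
  -- K^K/K! is one term of the series of e^K. The other factor of (K+1)! is handled by K - π/2 ≤ K +
  -- 1.
  have hexp : (K : ℝ) ^ K / K.factorial ≤ exp K := pow_div_factorial_le_exp K (by positivity) K
  have hf : (0 : ℝ) < K.factorial := by positivity
  have hKK : (0 : ℝ) < (K : ℝ) ^ K := by positivity
  rw [zpow_neg, zpow_natCast, Nat.factorial_succ, div_le_div_iff₀ (by positivity) hpos]
  rw [div_le_iff₀ hf] at hexp
  have h1 : (K : ℝ) - π / 2 ≤ (K + 1 : ℕ) := by push_cast; linarith [pi_pos]
  have h2 : 1 ≤ exp K * ((K : ℝ) ^ K)⁻¹ * K.factorial := by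
    rw [mul_right_comm, ← div_eq_mul_inv, le_div_iff₀ hKK, one_mul]
    exact hexp
  push_cast at h1 ⊢
  calc 4 * (π / 2) ^ (K + 1) * ((K : ℝ) - π / 2)
      ≤ 4 * (π / 2) ^ (K + 1) * (((K : ℝ) + 1) * 1) := by rw [mul_one]; gcongr
    _ ≤ 4 * (π / 2) ^ (K + 1) * (((K : ℝ) + 1) * (exp K * ((K : ℝ) ^ K)⁻¹ * K.factorial)) := by
        gcongr
    _ = _ := by ring

end QFT

namespace QFT

open Real

/-! ### The Lebesgue constant: comparison with a cotangent sum -/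

/-- A division-free form of the monotone decrease of sin(Kt)/sin t: the addition formula for
sin((K+1)t) reduces it to the case K and to the decrease of cosine. -/
theorem sin_nat_mul_mul_sin_le (K : ℕ) {v w : ℝ} (hv : 0 ≤ v) (hvw : v ≤ w)
    (hw : K * w ≤ π / 4) : sin (K * w) * sin v ≤ sin (K * v) * sin w := by
  induction K with
  | zero => simp
  | succ K ih =>
    have hw0 : 0 ≤ w := hv.trans hvw
    push_cast at hw ⊢
    have hKw : (K : ℝ) * w ≤ π / 4 := by nlinarith
    have hw1 : w ≤ π / 4 := by nlinarith [mul_nonneg (Nat.cast_nonneg (α := ℝ) K) hw0]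
    have hKv : (K : ℝ) * v ≤ K * w := by gcongr
    have hKv0 : 0 ≤ (K : ℝ) * v := by positivity
    have hpi := pi_pos
    have h1 := ih hKw
    have hc1 : cos w ≤ cos v := cos_le_cos_of_nonneg_of_le_pi hv (by linarith) hvw
    have hc2 : cos (K * w) ≤ cos (K * v) :=
      cos_le_cos_of_nonneg_of_le_pi hKv0 (by linarith) hKv
    have hs1 : 0 ≤ sin v := sin_nonneg_of_nonneg_of_le_pi hv (by linarith)
    have hs2 : 0 ≤ sin w := sin_nonneg_of_nonneg_of_le_pi hw0 (by linarith)
    have hs3 : 0 ≤ sin (K * w) := sin_nonneg_of_nonneg_of_le_pi (by linarith) (by linarith)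
    have hc0 : 0 ≤ cos v := cos_nonneg_of_mem_Icc ⟨by linarith, by linarith⟩
    rw [add_mul, add_mul, one_mul, one_mul, sin_add, sin_add]
    have e1 : sin (K * w) * sin v * cos w ≤ sin (K * w) * sin v * cos v := by gcongr
    have e2 : sin (K * w) * sin v * cos v ≤ sin (K * v) * sin w * cos v := by gcongr
    have e3 : cos (K * w) * (sin w * sin v) ≤ cos (K * v) * (sin w * sin v) := by gcongr
    linarith

/-- On the interval between the largest Chebyshev root and `1`, the Chebyshev polynomial lies below
its chord. -/
theorem cos_nat_mul_mul_le {K : ℕ} (hK : 1 ≤ K) {u : ℝ} (hu : |u| ≤ π / (2 * K)) :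
    cos (K * u) * (1 - cos (π / (2 * K))) ≤ cos u - cos (π / (2 * K)) := by
  have hK0 : (0 : ℝ) < K := by exact_mod_cast hK
  have hK1 : (1 : ℝ) ≤ K := by exact_mod_cast hK
  have hpi := pi_pos
  set v := |u| / 2 with hv
  set w := π / (4 * K) with hw
  have hw2 : π / (2 * K) = 2 * w := by rw [hw]; field_simp; norm_num
  have hvu : cos u = cos (2 * v) := by rw [← cos_abs u, hv]; ring_nf
  have hKu : cos (K * u) = cos (2 * (K * v)) := by
    rw [← cos_abs (K * u), abs_mul, abs_of_pos hK0, hv]; ring_nf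
  have hvw : v ≤ w := by rw [hw2] at hu; linarith
  have hKw : K * w = π / 4 := by rw [hw]; field_simp
  have hv0 : 0 ≤ v := by positivity
  have h := sin_nat_mul_mul_sin_le K hv0 hvw hKw.le
  rw [hKw, sin_pi_div_four] at h
  rw [hw2, hvu, hKu, cos_two_mul', cos_two_mul', cos_two_mul', cos_sq', cos_sq', cos_sq']
  have hw1 : w ≤ π / 4 := by rw [← hKw]; nlinarith [hv0.trans hvw]
  have hs1 : 0 ≤ sin v := sin_nonneg_of_nonneg_of_le_pi hv0 (by linarith)
  -- In half angles the claim is sin² v ≤ 2 sin²(Kv) sin² w, the square of `h`.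
  have hsq := pow_le_pow_left₀ (by positivity) h 2
  rw [mul_pow, mul_pow, div_pow, sq_sqrt (by norm_num)] at hsq
  linarith

theorem cos_div_sin_nonneg {t : ℝ} (h0 : 0 ≤ t) (h1 : t ≤ π / 2) : 0 ≤ cos t / sin t :=
  div_nonneg (cos_nonneg_of_mem_Icc ⟨by linarith [pi_pos], h1⟩)
    (sin_nonneg_of_nonneg_of_le_pi h0 (by linarith [pi_pos]))

/-- A pair of cotangents symmetric about `a`, damped by `cos (K u)`, is largest at `u = 0`. -/
theorem cos_nat_mul_mul_cot_add_cot_le {K : ℕ} (hK : 1 ≤ K) {u a : ℝ} (hu : |u| < π / (2 * K))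
    (ha : π / (4 * K) ≤ a) (ha' : a ≤ π / 2) :
    cos (K * u) * (cos (a + u / 2) / sin (a + u / 2) + cos (a - u / 2) / sin (a - u / 2)) ≤
      2 * (cos a / sin a) := by
  have hK0 : (0 : ℝ) < K := by exact_mod_cast hK
  have hK1 : (1 : ℝ) ≤ K := by exact_mod_cast hK
  have hpi := pi_pos
  set w := π / (4 * K) with hw
  have hw2 : π / (2 * K) = 2 * w := by rw [hw]; field_simp; norm_num
  have hKw : K * w = π / 4 := by rw [hw]; field_simp
  have hw0 : 0 < w := by positivity
  have hw1 : w ≤ π / 4 := by rw [← hKw]; nlinarith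
  have hc := cos_nat_mul_mul_le hK hu.le
  rw [hw2] at hu hc
  rw [abs_lt] at hu
  have hsa : 0 < sin a := sin_pos_of_pos_of_lt_pi (by linarith) (by linarith)
  have hca : 0 ≤ cos a := cos_nonneg_of_mem_Icc ⟨by linarith, by linarith⟩
  have hs1 : 0 < sin (a + u / 2) := by
    apply sin_pos_of_pos_of_lt_pi <;> linarith
  have hs2 : 0 < sin (a - u / 2) := by
    apply sin_pos_of_pos_of_lt_pi <;> linarith
  have hprod : sin (a + u / 2) * sin (a - u / 2) = (cos u - cos (2 * a)) / 2 := by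
    have h1 := cos_sub (a + u / 2) (a - u / 2)
    have h2 := cos_add (a + u / 2) (a - u / 2)
    rw [show a + u / 2 - (a - u / 2) = u by ring] at h1
    rw [show a + u / 2 + (a - u / 2) = 2 * a by ring] at h2
    linarith
  have hsum : cos (a + u / 2) / sin (a + u / 2) + cos (a - u / 2) / sin (a - u / 2) =
      2 * (sin a * cos a) / (sin (a + u / 2) * sin (a - u / 2)) := by
    have h2 := sin_add (a + u / 2) (a - u / 2)
    rw [show a + u / 2 + (a - u / 2) = 2 * a by ring, sin_two_mul] at h2
    rw [div_add_div _ _ hs1.ne' hs2.ne']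
    congr 1
    linarith
  have hmono : cos (2 * a) ≤ cos (2 * w) :=
    cos_le_cos_of_nonneg_of_le_pi (by linarith) (by linarith) (by linarith)
  have hKu1 : cos (K * u) ≤ 1 := cos_le_one _
  -- At a = w this is the chord inequality `hc`; increasing a lowers cos 2a, which only helps
  -- because cos(Ku) ≤ 1.
  have hkey : cos (K * u) * sin a ^ 2 ≤ sin (a + u / 2) * sin (a - u / 2) := by
    rw [hprod]
    have : sin a ^ 2 = (1 - cos (2 * a)) / 2 := by rw [cos_two_mul', cos_sq']; ring
    rw [this]
    nlinarith
  rw [hsum, ← mul_div_assoc, div_le_iff₀ (mul_pos hs1 hs2)]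
  calc cos (K * u) * (2 * (sin a * cos a)) =
      2 * (cos a / sin a) * (cos (K * u) * sin a ^ 2) := by field_simp
    _ ≤ _ := by gcongr

/-- `|cot (t / 2)|`. -/
noncomputable def absCotHalf (t : ℝ) : ℝ := |cos (t / 2)| / |sin (t / 2)|

theorem absCotHalf_neg (t : ℝ) : absCotHalf (-t) = absCotHalf t := by
  rw [absCotHalf, absCotHalf, neg_div, cos_neg, sin_neg, abs_neg]

theorem absCotHalf_add_two_pi (t : ℝ) : absCotHalf (t + 2 * π) = absCotHalf t := by
  rw [absCotHalf, absCotHalf, show (t + 2 * π) / 2 = t / 2 + π by ring, cos_add_pi, sin_add_pi,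
    abs_neg, abs_neg]

theorem absCotHalf_sub_two_pi (t : ℝ) : absCotHalf (t - 2 * π) = absCotHalf t := by
  rw [← absCotHalf_add_two_pi (t - 2 * π), sub_add_cancel]

theorem absCotHalf_of_mem {t : ℝ} (h0 : 0 ≤ t) (h1 : t ≤ π) :
    absCotHalf t = cos (t / 2) / sin (t / 2) := by
  rw [absCotHalf, ← abs_div, abs_of_nonneg (cos_div_sin_nonneg (by linarith) (by linarith))]

/-- The sum of `|cot (· / 2)|` over the `2 K` equispaced translates of `θ`. -/
noncomputable def cotSum (K : ℕ) (θ : ℝ) : ℝ := ∑ m ∈ Finset.range (2 * K), absCotHalf (θ + π * m / K)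

theorem cotSum_add_pi_div {K : ℕ} (hK : 1 ≤ K) (θ : ℝ) : cotSum K (θ + π / K) = cotSum K θ := by
  have hK0 : (0 : ℝ) < K := by exact_mod_cast hK
  have h1 := Finset.sum_range_succ (fun m : ℕ => absCotHalf (θ + π * m / K)) (2 * K)
  have h2 := Finset.sum_range_succ' (fun m : ℕ => absCotHalf (θ + π * m / K)) (2 * K)
  have h3 : absCotHalf (θ + π * (2 * K : ℕ) / K) = absCotHalf (θ + π * (0 : ℕ) / K) := by
    rw [← absCotHalf_add_two_pi (θ + π * (0 : ℕ) / K)]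
    congr 1
    push_cast
    field_simp
    ring
  rw [cotSum, cotSum]
  have h4 : ∑ m ∈ Finset.range (2 * K), absCotHalf (θ + π / K + π * m / K) =
      ∑ m ∈ Finset.range (2 * K), absCotHalf (θ + π * (m + 1 : ℕ) / K) := by
    refine Finset.sum_congr rfl fun m _ => ?_
    congr 1
    push_cast
    ring
  rw [h4]
  linarith

theorem cotSum_add_nat_mul {K : ℕ} (hK : 1 ≤ K) (θ : ℝ) (p : ℕ) :
    cotSum K (θ + p * (π / K)) = cotSum K θ := by
  induction p with
  | zero => simp
  | succ p ih =>
    rw [← ih, ← cotSum_add_pi_div hK (θ + p * (π / K))]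
    congr 1
    push_cast
    ring

/-- The Lebesgue constant of trigonometric interpolation at `2 K` equispaced points, which is also
that of interpolation at the `K` Chebyshev roots. -/
noncomputable def cotMean (K : ℕ) : ℝ :=
  (∑ m ∈ Finset.range K, cos ((2 * m + 1) * π / (4 * K)) / sin ((2 * m + 1) * π / (4 * K))) / K

theorem abs_sin_mul_cotSum_le_of_mem {K : ℕ} (hK : 1 ≤ K) {θ : ℝ} (h0 : 0 < θ) (h1 : θ < π / K) :
    |sin (K * θ)| * cotSum K θ ≤ 2 * K * cotMean K := by
  have hK0 : (0 : ℝ) < K := by exact_mod_cast hK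
  have hpi := pi_pos
  set u := θ - π / (2 * K) with hu
  have hpK : π / K = 2 * (π / (2 * K)) := by field_simp
  have habs : |u| < π / (2 * K) := by rw [abs_lt]; constructor <;> linarith
  have hsin : |sin (K * θ)| = cos (K * u) := by
    have : cos (K * u) = sin (K * θ) := by
      rw [hu, mul_sub, show (K : ℝ) * (π / (2 * K)) = π / 2 by field_simp, cos_sub_pi_div_two]
    rw [this, abs_of_nonneg]
    apply sin_nonneg_of_nonneg_of_le_pi (by positivity)
    rw [lt_div_iff₀ hK0] at h1
    linarith
  -- The last K translates are reversed and reflected by evenness and 2π-periodicity, so that the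
  -- half-angles of each pair are symmetric about (2m+1)π/(4K).
  have hsplit : cotSum K θ = ∑ m ∈ Finset.range K,
      (absCotHalf (θ + π * m / K) + absCotHalf (π * (m + 1 : ℕ) / K - θ)) := by
    rw [cotSum, two_mul, Finset.sum_range_add, Finset.sum_add_distrib]
    congr 1
    rw [← Finset.sum_range_reflect]
    refine Finset.sum_congr rfl fun m hm => ?_
    have hm' := Finset.mem_range.mp hm
    rw [← absCotHalf_neg (π * (m + 1 : ℕ) / K - θ), ← absCotHalf_add_two_pi (-_)]
    congr 1
    have : ((K + (K - 1 - m) : ℕ) : ℝ) = 2 * K - 1 - m := by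
      rw [show K + (K - 1 - m) = 2 * K - 1 - m by omega, Nat.sub_sub,
        Nat.cast_sub (by omega)]
      push_cast
      ring
    rw [this]
    push_cast
    field_simp
    ring
  rw [hsin, hsplit, cotMean, mul_assoc, mul_div_cancel₀ _ hK0.ne', Finset.mul_sum, Finset.mul_sum]
  refine Finset.sum_le_sum fun m hm => ?_
  have hm' : (m : ℝ) + 1 ≤ K := by exact_mod_cast Finset.mem_range.mp hm
  have hmle : π * (m + 1 : ℕ) / K ≤ π := by
    rw [div_le_iff₀ hK0]; push_cast; gcongr
  have hm1 : π * m / K + π / K = π * (m + 1 : ℕ) / K := by push_cast; ring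
  have hm0 : 0 ≤ π * m / K := by positivity
  rw [absCotHalf_of_mem (by linarith) (by linarith), absCotHalf_of_mem (by linarith) (by linarith)]
  have key := cos_nat_mul_mul_cot_add_cot_le hK (a := (2 * m + 1) * π / (4 * K)) habs
    (by
      rw [div_le_div_iff_of_pos_right (by positivity)]
      nlinarith [Nat.cast_nonneg (α := ℝ) m])
    (by
      rw [div_le_div_iff₀ (by positivity) two_pos]
      nlinarith)
  rw [show (2 * m + 1) * π / (4 * K) + u / 2 = (θ + π * m / K) / 2 by
      rw [hu]; field_simp; ring,
    show (2 * m + 1) * π / (4 * K) - u / 2 = (π * (m + 1 : ℕ) / K - θ) / 2 by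
      rw [hu]; push_cast; field_simp; ring] at key
  exact key

/-- Both factors have period π/K, so θ may be moved into (0, π/K). -/
theorem abs_sin_mul_cotSum_le {K : ℕ} (hK : 1 ≤ K) {θ : ℝ} (h0 : 0 ≤ θ)
    (hs : sin (K * θ) ≠ 0) : |sin (K * θ)| * cotSum K θ ≤ 2 * K * cotMean K := by
  have hK0 : (0 : ℝ) < K := by exact_mod_cast hK
  have hpi := pi_pos
  set p := ⌊K * θ / π⌋₊ with hp
  have hp1 : (p : ℝ) ≤ K * θ / π := Nat.floor_le (by positivity)
  have hp2 : K * θ / π < p + 1 := Nat.lt_floor_add_one _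
  rw [le_div_iff₀ hpi] at hp1
  rw [div_lt_iff₀ hpi] at hp2
  set η := θ - p * (π / K) with hη
  have hθ : θ = η + p * (π / K) := by rw [hη]; ring
  have hKη : K * η = K * θ - p * π := by rw [hη]; field_simp
  have hne : (p : ℝ) * π ≠ K * θ := fun h => hs (by rw [← h]; exact sin_nat_mul_pi p)
  have hlt : (p : ℝ) * π < K * θ := lt_of_le_of_ne hp1 hne
  have hη0 : 0 < η := by
    have : 0 < K * η := by rw [hKη]; linarith
    exact pos_of_mul_pos_right this hK0.le
  have hη1 : η < π / K := by
    rw [lt_div_iff₀ hK0, mul_comm, hKη]; linarith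
  have hsin : |sin (K * θ)| = |sin (K * η)| := by
    rw [hKη, sin_sub_nat_mul_pi, abs_mul, abs_pow, abs_neg, abs_one, one_pow, one_mul]
  rw [hsin, hθ, cotSum_add_nat_mul hK]
  exact abs_sin_mul_cotSum_le_of_mem hK hη0 hη1

/-- Up to sign, sin θ/(cos θ - cos φ) is half the sum of the cotangents of (θ ± φ)/2; the triangle
inequality finishes. -/
theorem abs_sin_div_le_absCotHalf_add {θ φ : ℝ} (h : cos θ ≠ cos φ) :
    |sin θ| / |cos θ - cos φ| ≤ (absCotHalf (θ - φ) + absCotHalf (θ + φ)) / 2 := by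
  have hprod : cos θ - cos φ = -2 * sin ((θ + φ) / 2) * sin ((θ - φ) / 2) := cos_sub_cos θ φ
  have hsum : sin θ = sin ((θ + φ) / 2) * cos ((θ - φ) / 2) +
      cos ((θ + φ) / 2) * sin ((θ - φ) / 2) := by
    rw [← sin_add]; ring_nf
  have h0 : -2 * sin ((θ + φ) / 2) * sin ((θ - φ) / 2) ≠ 0 := by
    rw [← hprod]; exact sub_ne_zero.mpr h
  have h1 : sin ((θ + φ) / 2) ≠ 0 := fun h' => h0 (by rw [h']; ring)
  have h2 : sin ((θ - φ) / 2) ≠ 0 := fun h' => h0 (by rw [h']; ring)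
  have h1' := abs_pos.mpr h1
  have h2' := abs_pos.mpr h2
  rw [hprod, hsum, absCotHalf, absCotHalf, abs_mul, abs_mul, abs_neg, abs_two,
    div_le_iff₀ (by positivity)]
  refine (abs_add_le _ _).trans_eq ?_
  rw [abs_mul, abs_mul]
  field_simp

theorem abs_sin_div_one_sub_cos {θ : ℝ} (h : cos θ ≠ 1) :
    |sin θ| / |cos θ - 1| ≤ absCotHalf θ := by
  have := abs_sin_div_le_absCotHalf_add (θ := θ) (φ := 0) (by simpa using h)
  simpa using this

theorem abs_sin_div_one_add_cos {θ : ℝ} (h : cos θ ≠ -1) :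
    |sin θ| / |cos θ - -1| ≤ absCotHalf (θ + π) := by
  have := abs_sin_div_le_absCotHalf_add (θ := θ) (φ := π) (by simpa using h)
  rw [cos_pi, show θ - π = θ + π - 2 * π by ring, absCotHalf_sub_two_pi] at this
  simpa using this

theorem cos_ne_chebyshev_node {K : ℕ} (hK : 1 ≤ K) {θ : ℝ} (hs : sin (K * θ) ≠ 0) (j : ℕ) :
    cos θ ≠ Polynomial.Chebyshev.node K j := by
  intro h
  have hK0 : (K : ℝ) ≠ 0 := by positivity
  have h1 := Polynomial.Chebyshev.T_real_cos θ K
  rw [h, Polynomial.Chebyshev.node, Polynomial.Chebyshev.T_real_cos] at h1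
  rw [show ((K : ℤ) : ℝ) * (j * π / K) = j * π by push_cast; field_simp, cos_nat_mul_pi] at h1
  push_cast at h1
  apply hs
  have h2 := sin_sq_add_cos_sq (K * θ)
  rw [← h1, ← pow_mul, mul_comm j, pow_mul, neg_one_sq, one_pow] at h2
  exact pow_eq_zero_iff two_ne_zero |>.mp (by linarith)

/-- The contribution of the node `j` to `cotSum K θ`. -/
noncomputable def nodeCot (K : ℕ) (θ : ℝ) (j : ℕ) : ℝ :=
  if j = 0 then absCotHalf θ else if j = K then absCotHalf (θ + π)
  else absCotHalf (θ - j * π / K) + absCotHalf (θ + j * π / K)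

/-- Modulo 2π, the angles θ ± jπ/K run once through the 2K translates; the signs coincide only for j
= 0 and j = K. -/
theorem sum_nodeCot {K : ℕ} (hK : 1 ≤ K) (θ : ℝ) :
    ∑ j ∈ Finset.range (K + 1), nodeCot K θ j = cotSum K θ := by
  obtain ⟨m, rfl⟩ : ∃ m, K = m + 1 := ⟨K - 1, by omega⟩
  have h0 : nodeCot (m + 1) θ 0 = absCotHalf θ := by simp [nodeCot]
  have h1 : nodeCot (m + 1) θ (m + 1) = absCotHalf (θ + π) := by simp [nodeCot]
  have h2 : ∑ j ∈ Finset.range m, nodeCot (m + 1) θ (j + 1) =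
      ∑ j ∈ Finset.range m, absCotHalf (θ - (j + 1 : ℕ) * π / (m + 1 : ℕ)) +
      ∑ j ∈ Finset.range m, absCotHalf (θ + (j + 1 : ℕ) * π / (m + 1 : ℕ)) := by
    rw [← Finset.sum_add_distrib]
    refine Finset.sum_congr rfl fun j hj => ?_
    have := Finset.mem_range.mp hj
    rw [nodeCot, if_neg (by omega), if_neg (by omega)]
  have h3 : ∑ j ∈ Finset.range m, absCotHalf (θ + π * (m + 2 + j : ℕ) / (m + 1 : ℕ)) =
      ∑ j ∈ Finset.range m, absCotHalf (θ - (j + 1 : ℕ) * π / (m + 1 : ℕ)) := by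
    rw [← Finset.sum_range_reflect]
    refine Finset.sum_congr rfl fun j hj => ?_
    have hj' := Finset.mem_range.mp hj
    rw [← absCotHalf_add_two_pi (θ - _)]
    congr 1
    have : ((m + 2 + (m - 1 - j) : ℕ) : ℝ) = 2 * (m + 1) - (j + 1) := by
      have h : m + 2 + (m - 1 - j) + (j + 1) = 2 * (m + 1) := by omega
      have h' : ((m + 2 + (m - 1 - j) + (j + 1) : ℕ) : ℝ) = (2 * (m + 1) : ℕ) := by rw [h]
      push_cast at h' ⊢
      linarith
    rw [this]
    push_cast
    field_simp
    ring
  rw [cotSum, show 2 * (m + 1) = m + 2 + m by ring,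
    Finset.sum_range_add (fun j : ℕ => absCotHalf (θ + π * j / (m + 1 : ℕ))), h3,
    Finset.sum_range_succ _ (m + 1), Finset.sum_range_succ' _ m, h0, h1, h2,
    Finset.sum_range_succ _ (m + 1), Finset.sum_range_succ' _ m]
  have h4 : θ + π * ((m + 1 : ℕ) : ℝ) / ((m + 1 : ℕ) : ℝ) = θ + π := by
    field_simp
  rw [h4]
  simp only [Nat.cast_zero, mul_zero, zero_div, add_zero, mul_comm _ π]
  ring

theorem sum_abs_cardinal_le_of_sin_ne_zero {K : ℕ} (hK : 1 ≤ K) {θ : ℝ} (h0 : 0 ≤ θ)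
    (hs : sin (K * θ) ≠ 0) :
    ∑ α : Fin (K + 1), |(cardinal K α).eval ((1 - cos θ) / 2)| ≤ cotMean K := by
  have hK0 : (0 : ℝ) < K := by exact_mod_cast hK
  have hne := cos_ne_chebyshev_node hK hs
  have hterm : ∀ α : Fin (K + 1), |(cardinal K α).eval ((1 - cos θ) / 2)| ≤
      |sin (K * θ)| / (2 * K) * nodeCot K θ α := by
    intro α
    rw [abs_cardinal_eval hK α (hne α)]
    have hd : 0 < |cos θ - Polynomial.Chebyshev.node K α| := abs_pos.mpr (sub_ne_zero.mpr (hne α))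
    have he := endFactor_pos K α
    have hb : |sin θ| / |cos θ - Polynomial.Chebyshev.node K α| / endFactor K α ≤
        nodeCot K θ α / 2 := by
      -- At an end point the two cotangents coincide; the halved weight there matches their being
      -- counted once.
      by_cases hα : (α : ℕ) = 0 ∨ (α : ℕ) = K
      · rw [endFactor, if_pos hα]
        refine div_le_div_of_nonneg_right ?_ two_pos.le
        rcases hα with h | h
        · rw [nodeCot, if_pos h]
          have := hne α
          rw [h, Polynomial.Chebyshev.node_eq_one] at this ⊢
          exact abs_sin_div_one_sub_cos this
        · rw [nodeCot, if_neg (by omega), if_pos h]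
          have := hne α
          rw [h, Polynomial.Chebyshev.node_eq_neg_one (by omega)] at this ⊢
          exact abs_sin_div_one_add_cos this
      · rw [endFactor, if_neg hα, div_one, nodeCot, if_neg (by tauto), if_neg (by tauto)]
        exact abs_sin_div_le_absCotHalf_add (hne α)
    calc _ = |sin (K * θ)| / K *
          (|sin θ| / |cos θ - Polynomial.Chebyshev.node K α| / endFactor K α) := by
          rw [abs_mul]; field_simp
      _ ≤ |sin (K * θ)| / K * (nodeCot K θ α / 2) := by gcongr
      _ = _ := by field_simp
  calc _ ≤ ∑ α : Fin (K + 1), |sin (K * θ)| / (2 * K) * nodeCot K θ α :=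
        Finset.sum_le_sum fun α _ => hterm α
    _ = |sin (K * θ)| * cotSum K θ / (2 * K) := by
        rw [← Finset.mul_sum, Fin.sum_univ_eq_sum_range (nodeCot K θ), sum_nodeCot hK]
        ring
    _ ≤ cotMean K := by
        rw [div_le_iff₀ (by positivity), mul_comm (cotMean K)]
        exact abs_sin_mul_cotSum_le hK h0 hs

/-! ### The logarithmic bound -/

/-- Cleared of denominators, the difference of the two sides vanishes at 0 and has derivative
(t/3)(sin t - t cos t), nonnegative because t < tan t. -/
theorem cos_div_sin_le {x : ℝ} (h0 : 0 < x) (h1 : x < π / 2) :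
    cos x / sin x ≤ 1 / x - x / 3 := by
  have hs : 0 < sin x := sin_pos_of_pos_of_lt_pi h0 (by linarith [pi_pos])
  have hd : ∀ t, HasDerivAt (fun t => sin t * (1 - t ^ 2 / 3) - t * cos t)
      (t / 3 * (sin t - t * cos t)) t := by
    intro t
    have h := ((hasDerivAt_sin t).mul (((hasDerivAt_pow 2 t).div_const 3).const_sub 1)).sub
      ((hasDerivAt_id t).mul (hasDerivAt_cos t))
    convert! h using 1
    simp
    ring
  have hmono : MonotoneOn (fun t => sin t * (1 - t ^ 2 / 3) - t * cos t) (Set.Icc 0 x) := by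
    apply monotoneOn_of_deriv_nonneg (convex_Icc 0 x)
      (fun t _ => (hd t).continuousAt.continuousWithinAt)
      (fun t _ => (hd t).differentiableAt.differentiableWithinAt)
    intro t ht
    rw [interior_Icc] at ht
    rw [(hd t).deriv]
    have hc : 0 < cos t := cos_pos_of_mem_Ioo ⟨by linarith [ht.1, pi_pos], by linarith [ht.2]⟩
    have htan := lt_tan ht.1 (ht.2.trans h1)
    rw [tan_eq_sin_div_cos, lt_div_iff₀ hc] at htan
    exact mul_nonneg (by linarith [ht.1]) (by linarith)
  have h := hmono (Set.left_mem_Icc.mpr h0.le) (Set.right_mem_Icc.mpr h0.le) h0.le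
  simp at h
  rw [div_le_iff₀ hs, show (1 / x - x / 3) * sin x = sin x * (1 - x ^ 2 / 3) / x by field_simp,
    le_div_iff₀ h0]
  linarith

theorem two_div_le_log {x : ℝ} (hx : 0 < x) : 2 / (2 * x + 1) ≤ log ((x + 1) / x) := by
  have h := hasSum_log_one_add_inv hx
  have h1 : 2 * (1 / (2 * ((0 : ℕ) : ℝ) + 1)) * (1 / (2 * x + 1)) ^ (2 * 0 + 1) ≤
      log (1 + x⁻¹) := le_hasSum h 0 fun j _ => by positivity
  rw [show (x + 1) / x = 1 + x⁻¹ by field_simp]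
  simpa [div_eq_mul_inv] using h1

/-- The constant 0.99 is just large enough for K = 2 (4/3 against about 1.337) and fails at K = 1.
-/
theorem sum_inv_odd_le {K : ℕ} (hK : 2 ≤ K) :
    ∑ m ∈ Finset.range K, 1 / (2 * (m : ℝ) + 1) ≤ 0.99 + log K / 2 := by
  induction K, hK using Nat.le_induction with
  | base =>
    have := log_two_gt_d9
    norm_num [Finset.sum_range_succ]
    linarith
  | succ K hK ih =>
    have hK0 : (0 : ℝ) < K := by positivity
    have h := two_div_le_log hK0
    rw [log_div (by positivity) hK0.ne', show 2 / (2 * (K : ℝ) + 1) = 2 * (1 / (2 * K + 1)) by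
      ring] at h
    rw [Finset.sum_range_succ]
    push_cast
    linarith

theorem sum_odd (K : ℕ) : ∑ m ∈ Finset.range K, (2 * (m : ℝ) + 1) = K ^ 2 := by
  induction K with
  | zero => simp
  | succ K ih => rw [Finset.sum_range_succ, ih]; push_cast; ring

theorem cotMean_le {K : ℕ} (hK : 1 ≤ K) : cotMean K ≤ 1 + 2 / π * log ((K : ℝ) + 1) := by
  have hpi := pi_pos
  have hpi3 := pi_gt_d2
  have hK0 : (0 : ℝ) < K := by exact_mod_cast hK
  have hlog : 0 ≤ log ((K : ℝ) + 1) := log_nonneg (by linarith)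
  rcases eq_or_lt_of_le hK with rfl | h2
  · have : cotMean 1 = 1 := by
      have h : (√2 / 2 : ℝ) ≠ 0 := by positivity
      simp [cotMean]
    rw [this]
    have : 0 ≤ 2 / π * log (((1 : ℕ) : ℝ) + 1) := by positivity
    linarith
  have hterm : ∀ m ∈ Finset.range K,
      cos ((2 * m + 1) * π / (4 * K)) / sin ((2 * m + 1) * π / (4 * K)) ≤
      4 * K / π * (1 / (2 * (m : ℝ) + 1)) - π / (12 * K) * (2 * (m : ℝ) + 1) := by
    intro m hm
    have hm' : (m : ℝ) + 1 ≤ K := by exact_mod_cast Finset.mem_range.mp hm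
    refine (cos_div_sin_le (by positivity) ?_).trans_eq ?_
    · rw [div_lt_div_iff₀ (by positivity) two_pos]
      nlinarith
    · field_simp
      ring
  have hsum := Finset.sum_le_sum hterm
  rw [Finset.sum_sub_distrib, ← Finset.mul_sum, ← Finset.mul_sum, sum_odd] at hsum
  have hodd := sum_inv_odd_le h2
  have hlogK : log K ≤ log ((K : ℝ) + 1) := log_le_log hK0 (by linarith)
  have h1 : 4 * K / π * ∑ m ∈ Finset.range K, 1 / (2 * (m : ℝ) + 1) ≤
      4 * K / π * (0.99 + log ((K : ℝ) + 1) / 2) := by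
    gcongr
    linarith
  rw [cotMean, div_le_iff₀ hK0]
  refine hsum.trans ((sub_le_sub_right h1 _).trans ?_)
  have h3 : π / (12 * K) * (K : ℝ) ^ 2 = K * (π / 12) := by field_simp
  -- The left side is about 0.9987; the term -π/12, which comes from -x/3 in the cotangent bound, is
  -- indispensable.
  have h4 : 4 * 0.99 / π - π / 12 ≤ 1 := by
    rw [sub_le_iff_le_add, div_le_iff₀ hpi]
    nlinarith
  rw [h3, show 4 * K / π * (0.99 + log ((K : ℝ) + 1) / 2) - K * (π / 12) =
    (4 * 0.99 / π - π / 12) * K + 2 / π * log ((K : ℝ) + 1) * K by ring, add_mul]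
  gcongr

theorem sum_abs_cardinal_le {K : ℕ} (hK : 1 ≤ K) {x : ℝ} (hx : x ∈ Set.Icc (0 : ℝ) 1) :
    ∑ α : Fin (K + 1), |(cardinal K α).eval x| ≤ 1 + 2 / π * log ((K : ℝ) + 1) := by
  have hK0 : (0 : ℝ) < K := by exact_mod_cast hK
  set θ := arccos (1 - 2 * x) with hθ
  have hc : cos θ = 1 - 2 * x := cos_arccos (by linarith [hx.2]) (by linarith [hx.1])
  have hxθ : x = (1 - cos θ) / 2 := by rw [hc]; ring
  -- Here x is itself a node, where the sum is 1 and the barycentric formula is unavailable.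
  by_cases hs : sin (K * θ) = 0
  · have hlog : 0 ≤ log ((K : ℝ) + 1) := log_nonneg (by linarith)
    have hpos : 0 ≤ 2 / π * log ((K : ℝ) + 1) := by have := pi_pos; positivity
    obtain ⟨β, hβ⟩ : ∃ β, x = node K β := by
      obtain ⟨n, hn⟩ := sin_eq_zero_iff.mp hs
      have hθ0 : 0 ≤ θ := arccos_nonneg _
      have hθ1 : θ ≤ π := arccos_le_pi _
      have hn0 : 0 ≤ n := by
        have : (0 : ℝ) ≤ n := by
          apply nonneg_of_mul_nonneg_left _ pi_pos
          rw [hn]; positivity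
        exact_mod_cast this
      lift n to ℕ using hn0
      have hnK : n ≤ K := by
        have : (n : ℝ) ≤ K := by
          apply le_of_mul_le_mul_right _ pi_pos
          push_cast at hn
          rw [hn]; gcongr
        exact_mod_cast this
      refine ⟨⟨n, Nat.lt_succ_of_le hnK⟩, ?_⟩
      rw [hxθ, node]
      congr 3
      push_cast at hn
      rw [mul_comm π, hn]
      field_simp
    rw [hβ]
    simp only [cardinal_eval_node]
    rw [Finset.sum_eq_single β (by intro b _ hb; simp [hb]) (by simp)]
    simpa using hpos
  · rw [hxθ]
    exact (sum_abs_cardinal_le_of_sin_ne_zero hK (arccos_nonneg _) hs).trans (cotMean_le hK)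

/-! ### Bounds and exact values for the Lebesgue constant -/

theorem sum_abs_cardinal_le_lebesgueConst {K : ℕ} (hK : 1 ≤ K) {x : ℝ}
    (hx : x ∈ Set.Icc (0 : ℝ) 1) :
    ∑ α : Fin (K + 1), |(cardinal K α).eval x| ≤ lebesgueConst K := by
  refine le_ciSup (f := fun x : Set.Icc (0 : ℝ) 1 =>
    ∑ α : Fin (K + 1), |(cardinal K α).eval (x : ℝ)|)
    ⟨1 + 2 / π * log ((K : ℝ) + 1), ?_⟩ (⟨x, hx⟩ : Set.Icc (0 : ℝ) 1)
  rintro _ ⟨y, rfl⟩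
  exact sum_abs_cardinal_le hK y.2

theorem lebesgueConst_le {K : ℕ} (hK : 1 ≤ K) :
    lebesgueConst K ≤ 1 + 2 / π * log ((K : ℝ) + 1) :=
  ciSup_le fun x => sum_abs_cardinal_le hK x.2

theorem lebesgueConst_one : lebesgueConst 1 = 1 := by
  have h0 : node 1 0 = 0 := by simp [node]
  have h1 : node 1 1 = 1 := by simp [node]
  have hsum : ∀ x : Set.Icc (0 : ℝ) 1, ∑ α : Fin (1 + 1), |(cardinal 1 α).eval (x : ℝ)| = 1 := by
    intro x
    have e0 : (cardinal 1 0).eval (x : ℝ) = 1 - x := by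
      rw [cardinal, show (Finset.univ : Finset (Fin (1 + 1))) = {0, 1} from rfl,
        Lagrange.basis_pair_left (by decide), Lagrange.basisDivisor, h0, h1]
      simp
    have e1 : (cardinal 1 1).eval (x : ℝ) = x := by
      rw [cardinal, show (Finset.univ : Finset (Fin (1 + 1))) = {0, 1} from rfl,
        Lagrange.basis_pair_right (by decide), Lagrange.basisDivisor, h0, h1]
      simp
    rw [Fin.sum_univ_two, e0, e1, abs_of_nonneg (by linarith [x.2.2]), abs_of_nonneg x.2.1]
    ring
  rw [lebesgueConst]
  simp only [hsum]
  exact ciSup_const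

/-- The cardinal functions sum to 1, and P^0 is negative midway between the second and third nodes,
so taking absolute values strictly increases the sum there. -/
theorem one_lt_lebesgueConst {K : ℕ} (hK : 2 ≤ K) : 1 < lebesgueConst K := by
  obtain ⟨m, rfl⟩ : ∃ m, K = m + 2 := ⟨K - 2, by omega⟩
  set x := (node (m + 2) 1 + node (m + 2) 2) / 2 with hx
  have h12 : node (m + 2) 1 < node (m + 2) 2 := node_strictMono _ (by
    rw [Fin.lt_def, Fin.val_one, Fin.val_two]; norm_num)
  have hmem : x ∈ Set.Icc (0 : ℝ) 1 := by
    have a := node_mem_Icc (m + 2) 1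
    have b := node_mem_Icc (m + 2) 2
    constructor <;> linarith [a.1, a.2, b.1, b.2]
  have hneg : (cardinal (m + 2) 0).eval x < 0 := by
    rw [cardinal, Lagrange.basis, Polynomial.eval_prod,
      ← Finset.mul_prod_erase _ _ (a := (1 : Fin (m + 2 + 1))) (by simp)]
    simp only [Lagrange.basisDivisor, Polynomial.eval_mul, Polynomial.eval_C, Polynomial.eval_sub,
      Polynomial.eval_X]
    apply mul_neg_of_neg_of_pos
    · apply mul_neg_of_neg_of_pos
      · rw [inv_lt_zero, sub_neg]
        exact node_strictMono _ (by rw [Fin.lt_def]; simp)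
      · linarith
    · refine Finset.prod_pos fun j hj => ?_
      simp only [Finset.mem_erase, Finset.mem_univ, and_true] at hj
      have hj2 : 2 ≤ j := by
        have a : (j : ℕ) ≠ 0 := fun h => hj.2 (Fin.ext h)
        have b : (j : ℕ) ≠ 1 := fun h => hj.1 (Fin.ext (by simpa using h))
        rw [Fin.le_def, Fin.val_two]
        omega
      have hle := (node_strictMono (m + 2)).monotone hj2
      have hlt : node (m + 2) 0 < node (m + 2) j := node_strictMono _ (Fin.pos_of_ne_zero hj.2)
      apply mul_pos_of_neg_of_neg
      · rw [inv_lt_zero]; linarith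
      · linarith
  refine lt_of_lt_of_le ?_ (sum_abs_cardinal_le_lebesgueConst (by omega) hmem)
  rw [← sum_cardinal_eval (m + 2) x]
  exact Finset.sum_lt_sum (fun i _ => le_abs_self _)
    ⟨0, Finset.mem_univ _, hneg.trans_le (abs_nonneg _)⟩

end QFT

namespace QFT

open Real

/-! ### The matrix product operator -/

theorem norm_planeWave (y x : ℝ) : ‖planeWave y x‖ = 1 := by
  rw [planeWave_eq, Complex.norm_exp_ofReal_mul_I]

theorem planeWave_zero (y : ℝ) : planeWave y 0 = 1 := by simp [planeWave]

/-- The phase factor of a core. -/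
theorem core_phase_eq (x : ℝ) (σ τ : Fin 2) :
    Complex.exp (-(π * Complex.I * (((σ : ℕ) : ℂ) + (x : ℂ)) * ((τ : ℕ) : ℂ))) =
      planeWave (τ : ℕ) (((σ : ℕ) + x) / 2) := by
  rw [planeWave]
  congr 1
  push_cast
  ring

theorem core_eq (K : ℕ) (α β : Fin (K + 1)) (σ τ : Fin 2) :
    core K α β σ τ = (((cardinal K α).eval (((σ : ℕ) + node K β) / 2) : ℝ) : ℂ) *
      planeWave (τ : ℕ) (((σ : ℕ) + node K β) / 2) := by
  rw [core, core_phase_eq]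

theorem leftCore_eq (K : ℕ) (β : Fin (K + 1)) (σ τ : Fin 2) :
    leftCore K β σ τ = planeWave (τ : ℕ) (((σ : ℕ) + node K β) / 2) := by
  rw [leftCore]
  simp only [core_eq]
  rw [← Finset.sum_mul, ← Complex.ofReal_sum, sum_cardinal_eval, Complex.ofReal_one, one_mul]

theorem planeWave_half_mul_planeWave (y x : ℝ) (σ τ : Fin 2) :
    planeWave y (((σ : ℕ) + x) / 2) * planeWave (τ : ℕ) (((σ : ℕ) + x) / 2) =
      planeWave ((y + (τ : ℕ)) / 2) (σ : ℕ) * planeWave ((y + (τ : ℕ)) / 2) x := by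
  rw [planeWave, planeWave, planeWave, planeWave, ← Complex.exp_add, ← Complex.exp_add]
  congr 1
  push_cast
  ring

theorem bit_le_one (b : Fin 2) : ((b : ℕ) : ℝ) ≤ 1 := by
  exact_mod_cast Nat.lt_succ_iff.mp b.2

theorem half_bit_add_mem_Icc {x : ℝ} (hx : x ∈ Set.Icc (0 : ℝ) 1) (b : Fin 2) :
    ((b : ℕ) + x) / 2 ∈ Set.Icc (0 : ℝ) 1 := by
  have := bit_le_one b
  have h0 : (0 : ℝ) ≤ (b : ℕ) := Nat.cast_nonneg _
  constructor <;> linarith [hx.1, hx.2]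

theorem half_add_bit_mem_Icc {x : ℝ} (hx : x ∈ Set.Icc (0 : ℝ) 1) (b : Fin 2) :
    (x + (b : ℕ)) / 2 ∈ Set.Icc (0 : ℝ) 1 := by
  rw [add_comm]; exact half_bit_add_mem_Icc hx b

/-- Contracting an approximate plane wave with a core multiplies its error by at most the Lebesgue
constant and adds one interpolation error. -/
theorem norm_sum_mul_core_sub_le {K : ℕ} (hK : 1 ≤ K) {L : Fin (K + 1) → ℂ} {c : ℂ} (hc : ‖c‖ = 1)
    {y ε : ℝ} (hy : y ∈ Set.Icc (0 : ℝ) 1) (hL : ∀ α, ‖L α - c * planeWave y (node K α)‖ ≤ ε)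
    (σ τ : Fin 2) (β : Fin (K + 1)) :
    ‖∑ α, L α * core K α β σ τ - c * planeWave ((y + (τ : ℕ)) / 2) (σ : ℕ) *
      planeWave ((y + (τ : ℕ)) / 2) (node K β)‖ ≤ lebesgueConst K * ε + interpError K := by
  set x := ((σ : ℕ) + node K β) / 2 with hx
  have hxm : x ∈ Set.Icc (0 : ℝ) 1 := half_bit_add_mem_Icc (node_mem_Icc K β) σ
  have hε : 0 ≤ ε := (norm_nonneg _).trans (hL 0)
  -- Inherited error propagated by the cardinal values, minus a fresh interpolation error, all times
  -- a unimodular phase.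
  have hsplit : ∑ α, L α * core K α β σ τ - c * planeWave ((y + (τ : ℕ)) / 2) (σ : ℕ) *
      planeWave ((y + (τ : ℕ)) / 2) (node K β) =
      (∑ α, (L α - c * planeWave y (node K α)) * (((cardinal K α).eval x : ℝ) : ℂ) -
        c * (planeWave y x - interp K (planeWave y) x)) * planeWave (τ : ℕ) x := by
    rw [mul_assoc c, ← planeWave_half_mul_planeWave, ← hx, interp, mul_sub, Finset.mul_sum]
    simp only [sub_mul, Finset.sum_sub_distrib, Finset.sum_mul, core_eq, ← hx, ← mul_assoc]
    ring
  have hsum : ‖∑ α, (L α - c * planeWave y (node K α)) * (((cardinal K α).eval x : ℝ) : ℂ)‖ ≤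
      lebesgueConst K * ε := by
    calc _ ≤ ∑ α, ‖(L α - c * planeWave y (node K α)) * (((cardinal K α).eval x : ℝ) : ℂ)‖ :=
          norm_sum_le _ _
      _ ≤ ∑ α, ε * |(cardinal K α).eval x| := by
          refine Finset.sum_le_sum fun α _ => ?_
          rw [norm_mul, Complex.norm_real, Real.norm_eq_abs]
          gcongr
          exact hL α
      _ = (∑ α, |(cardinal K α).eval x|) * ε := by rw [← Finset.mul_sum, mul_comm]
      _ ≤ _ := by
          gcongr
          exact sum_abs_cardinal_le_lebesgueConst hK hxm
  rw [hsplit, norm_mul, norm_planeWave, mul_one]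
  refine (norm_sub_le _ _).trans (add_le_add hsum ?_)
  rw [norm_mul, hc, one_mul]
  exact norm_sub_interp_le_interpError hK hy hxm

/-- The contraction of a row vector with `m` internal cores and the rightmost core. -/
noncomputable def chainSum (K m : ℕ) (L : Fin (K + 1) → ℂ) (σ τ : Fin (m + 1) → Fin 2) : ℂ :=
  ∑ α : Fin (m + 1) → Fin (K + 1),
    L (α 0) *
      (∏ k : Fin m, core K (α k.castSucc) (α k.succ) (σ k.castSucc) (τ k.castSucc)) *
      rightCore K (α (Fin.last m)) (σ (Fin.last m)) (τ (Fin.last m))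

theorem mpoTensor_eq_chainSum (K m : ℕ) (σ τ : Fin (m + 2) → Fin 2) :
    mpoTensor m (leftCore K) (core K) (rightCore K) σ τ =
      chainSum K m (fun α => leftCore K α (σ 0) (τ 0)) (Fin.tail σ) (Fin.tail τ) := rfl

theorem chainSum_zero (K : ℕ) (L : Fin (K + 1) → ℂ) (σ τ : Fin 1 → Fin 2) :
    chainSum K 0 L σ τ = ∑ α, L α * core K α 0 (σ 0) (τ 0) := by
  rw [chainSum, ← (Equiv.funUnique (Fin 1) (Fin (K + 1))).sum_comp]
  simp [rightCore]

/-- Summing over the first bond index absorbs the first core into the row vector, which is what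
makes induction on the sites possible. -/
theorem chainSum_succ (K m : ℕ) (L : Fin (K + 1) → ℂ) (σ τ : Fin (m + 2) → Fin 2) :
    chainSum K (m + 1) L σ τ =
      chainSum K m (fun β => ∑ α, L α * core K α β (σ 0) (τ 0)) (Fin.tail σ) (Fin.tail τ) := by
  rw [chainSum, ← (Fin.consEquiv fun _ : Fin (m + 2) => Fin (K + 1)).sum_comp,
    Fintype.sum_prod_type, Finset.sum_comm, chainSum]
  refine Finset.sum_congr rfl fun α _ => ?_
  rw [Finset.sum_mul, Finset.sum_mul]
  refine Finset.sum_congr rfl fun a _ => ?_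
  rw [Fin.prod_univ_succ]
  simp only [Fin.consEquiv_apply, Fin.cons_zero, Fin.castSucc_zero, Fin.cons_succ,
    ← Fin.succ_castSucc, ← Fin.succ_last, Fin.tail]
  ring

/-- The exact contraction: the plane wave of frequency `y` is folded one site at a time. -/
noncomputable def foldedWave : (n : ℕ) → ℝ → (Fin n → Fin 2) → (Fin n → Fin 2) → ℂ
  | 0 => fun _ _ _ => 1
  | n + 1 => fun y σ τ => planeWave ((y + (τ 0 : ℕ)) / 2) (σ 0 : ℕ) *
      foldedWave n ((y + (τ 0 : ℕ)) / 2) (Fin.tail σ) (Fin.tail τ)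

theorem foldedWave_succ (n : ℕ) (y : ℝ) (σ τ : Fin (n + 1) → Fin 2) :
    foldedWave (n + 1) y σ τ = planeWave ((y + (τ 0 : ℕ)) / 2) (σ 0 : ℕ) *
      foldedWave n ((y + (τ 0 : ℕ)) / 2) (Fin.tail σ) (Fin.tail τ) := rfl

theorem rowIndex_succ {n : ℕ} (σ : Fin (n + 1) → Fin 2) :
    rowIndex σ = 2 ^ n * (σ 0 : ℕ) + rowIndex (Fin.tail σ) := by
  rw [rowIndex, Fin.sum_univ_succ, rowIndex]
  simp only [Fin.val_zero, Fin.val_succ, Fin.tail, Nat.add_sub_cancel, Nat.sub_zero]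
  congr 1
  refine Finset.sum_congr rfl fun k _ => ?_
  rw [show n - ((k : ℕ) + 1) = n - 1 - k by omega]

theorem colIndex_succ {n : ℕ} (τ : Fin (n + 1) → Fin 2) :
    colIndex τ = (τ 0 : ℕ) + 2 * colIndex (Fin.tail τ) := by
  rw [colIndex, Fin.sum_univ_succ, colIndex, Finset.mul_sum]
  simp only [Fin.val_zero, Fin.val_succ, Fin.tail, pow_zero, one_mul]
  congr 1
  refine Finset.sum_congr rfl fun k _ => ?_
  ring

theorem foldedWave_eq (n : ℕ) : ∀ (y : ℝ) (σ τ : Fin n → Fin 2),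
    foldedWave n y σ τ =
      Complex.exp (-(2 * π * Complex.I * rowIndex σ * (y + colIndex τ) / 2 ^ n)) := by
  induction n with
  | zero => intro y σ τ; simp [foldedWave, rowIndex]
  | succ n ih =>
    intro y σ τ
    rw [foldedWave_succ, ih, planeWave, ← Complex.exp_add, rowIndex_succ, colIndex_succ]
    have h2 : (2 : ℂ) ^ n ≠ 0 := pow_ne_zero n two_ne_zero
    -- The product of the leading row bit with the remaining column index contributes an integer
    -- multiple of 2πi.
    refine (Complex.exp_periodic.sub_nat_mul_eq
      ((σ 0 : ℕ) * colIndex (Fin.tail τ))).symm.trans ?_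
    congr 1
    push_cast
    field_simp
    ring

theorem foldedWave_zero_eq_dftTensor (n : ℕ) (σ τ : Fin n → Fin 2) :
    foldedWave n 0 σ τ = dftTensor n σ τ := by
  rw [foldedWave_eq, dftTensor, dftEntry]
  push_cast
  rw [zero_add]

theorem norm_chainSum_sub_le {K : ℕ} (hK : 1 ≤ K) (m : ℕ) : ∀ {L : Fin (K + 1) → ℂ} {c : ℂ},
    ‖c‖ = 1 → ∀ {y ε : ℝ}, y ∈ Set.Icc (0 : ℝ) 1 →
      (∀ α, ‖L α - c * planeWave y (node K α)‖ ≤ ε) → ∀ σ τ : Fin (m + 1) → Fin 2,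
      ‖chainSum K m L σ τ - c * foldedWave (m + 1) y σ τ‖ ≤ lebesgueConst K ^ (m + 1) * ε +
        (∑ i ∈ Finset.range (m + 1), lebesgueConst K ^ i) * interpError K := by
  induction m with
  | zero =>
    intro L c hc y ε hy hL σ τ
    have h := norm_sum_mul_core_sub_le hK hc hy hL (σ 0) (τ 0) 0
    -- The right core closes the bond at the node 0, where every plane wave equals 1.
    rw [node_zero, planeWave_zero, mul_one] at h
    rw [chainSum_zero]
    simpa [foldedWave] using h
  | succ m ih =>
    intro L c hc y ε hy hL σ τ
    have h := ih (c := c * planeWave ((y + (τ 0 : ℕ)) / 2) (σ 0 : ℕ))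
      (by rw [norm_mul, hc, norm_planeWave, one_mul]) (half_add_bit_mem_Icc hy (τ 0))
      (norm_sum_mul_core_sub_le hK hc hy hL (σ 0) (τ 0)) (Fin.tail σ) (Fin.tail τ)
    rw [chainSum_succ, foldedWave_succ, ← mul_assoc]
    refine h.trans_eq ?_
    rw [Finset.sum_range_succ _ (m + 1)]
    ring

theorem norm_dftMPO_sub_le {K : ℕ} (hK : 1 ≤ K) {n : ℕ} (hn : 1 ≤ n) (σ τ : Fin n → Fin 2) :
    ‖dftMPO K n σ τ - dftTensor n σ τ‖ ≤
      (∑ i ∈ Finset.range (n - 1), lebesgueConst K ^ i) * interpError K := by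
  have hL : ∀ (α : Fin (K + 1)) (s t : Fin 2), leftCore K α s t =
      planeWave ((0 + (t : ℕ)) / 2) (s : ℕ) * planeWave ((0 + (t : ℕ)) / 2) (node K α) := by
    intro α s t
    rw [leftCore_eq, ← planeWave_half_mul_planeWave]
    simp [planeWave]
  rw [← foldedWave_zero_eq_dftTensor]
  match n, hn with
  | 1, _ => simp [dftMPO, foldedWave, hL, node_zero, planeWave_zero]
  | m + 2, _ =>
    rw [dftMPO, mpoTensor_eq_chainSum, foldedWave_succ]
    -- The left core is already an exact plane wave, so the error recursion starts from ε = 0.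
    have h := norm_chainSum_sub_le hK m (norm_planeWave ((0 + (τ 0 : ℕ)) / 2) (σ 0 : ℕ))
      (half_add_bit_mem_Icc (Set.left_mem_Icc.mpr zero_le_one) (τ 0)) (ε := 0)
      (L := fun α => leftCore K α (σ 0) (τ 0)) (fun α => by rw [hL, sub_self, norm_zero])
      (Fin.tail σ) (Fin.tail τ)
    simpa using h

theorem tensorNorm_dftMPO_sub_le {K : ℕ} (hK : 1 ≤ K) {n : ℕ} (hn : 1 ≤ n) :
    tensorNorm (dftMPO K n - dftTensor n) ≤
      (∑ i ∈ Finset.range (n - 1), lebesgueConst K ^ i) * interpError K :=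
  Finset.sup'_le _ _ fun p _ => norm_dftMPO_sub_le hK hn p.1 p.2

/-- Each of the n - 1 powers is at most the last one. For n ≤ 1 truncated subtraction makes both
sides 0. -/
theorem geom_sum_le_mul_pow {x : ℝ} (hx : 1 ≤ x) (n : ℕ) :
    ∑ i ∈ Finset.range (n - 1), x ^ i ≤ ((n - 1 : ℕ) : ℝ) * x ^ (n - 2) := by
  calc _ ≤ ∑ _i ∈ Finset.range (n - 1), x ^ (n - 2) := by
        refine Finset.sum_le_sum fun i hi => pow_le_pow_right₀ hx ?_
        have := Finset.mem_range.mp hi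
        omega
    _ = _ := by rw [Finset.sum_const, Finset.card_range, nsmul_eq_mul]

end QFT

theorem mainTheorem1 (K n : ℕ) (hK : 1 ≤ K) (hn : 1 ≤ n) :
    -- closed forms of the boundary cores
    (∀ (β : Fin (K + 1)) (σ τ : Fin 2),
      QFT.leftCore K β σ τ =
        Complex.exp (-(Real.pi * Complex.I * (((σ : ℕ) : ℂ) + (QFT.node K β : ℂ)) *
          ((τ : ℕ) : ℂ)))) ∧
    (∀ (α : Fin (K + 1)) (σ τ : Fin 2),
      QFT.rightCore K α σ τ =
        (((QFT.cardinal K α).eval (((σ : ℕ) : ℝ) / 2) : ℝ) : ℂ) *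
          Complex.exp (-(Real.pi * Complex.I * ((σ : ℕ) : ℂ) * ((τ : ℕ) : ℂ)))) ∧
    -- entrywise error bound
    (2 ≤ K → 1 < QFT.lebesgueConst K ∧
      QFT.tensorNorm (QFT.dftMPO K n - QFT.dftTensor n) ≤
        (QFT.lebesgueConst K ^ (n - 1) - 1) / (QFT.lebesgueConst K - 1) * QFT.interpError K ∧
      (QFT.lebesgueConst K ^ (n - 1) - 1) / (QFT.lebesgueConst K - 1) * QFT.interpError K ≤
        ((n : ℝ) - 1) * QFT.lebesgueConst K ^ (n - 2) * QFT.interpError K) ∧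
    -- for `K = 1` the quotient is `0 / 0`, and its limiting value is `n - 1`
    (K = 1 → QFT.lebesgueConst K = 1 ∧
      QFT.tensorNorm (QFT.dftMPO K n - QFT.dftTensor n) ≤
        ((n : ℝ) - 1) * QFT.interpError K) ∧
    -- bounds on the Lebesgue constant and on the interpolation error
    QFT.lebesgueConst K ≤ 1 + 2 / Real.pi * Real.log ((K : ℝ) + 1) ∧
    (2 ≤ K → QFT.interpError K ≤
      4 * (Real.pi / 2) ^ (K + 1) * Real.exp K * (K : ℝ) ^ (-(K : ℤ)) /
        ((K : ℝ) - Real.pi / 2)) := by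

  have hgeom := QFT.tensorNorm_dftMPO_sub_le hK hn
  have hcast : ((n - 1 : ℕ) : ℝ) = (n : ℝ) - 1 := by rw [Nat.cast_sub hn, Nat.cast_one]
  refine ⟨fun β σ τ => ?_, fun α σ τ => ?_, fun hK2 => ?_, fun hK1 => ?_,
    QFT.lebesgueConst_le hK, QFT.interpError_le⟩
  · rw [QFT.leftCore_eq, QFT.core_phase_eq]
  · rw [QFT.rightCore, QFT.core, QFT.node_zero, Complex.ofReal_zero, add_zero, add_zero]
  · have h1 := QFT.one_lt_lebesgueConst hK2
    rw [← geom_sum_eq h1.ne', ← hcast]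
    exact ⟨h1, hgeom, mul_le_mul_of_nonneg_right (QFT.geom_sum_le_mul_pow h1.le n)
      (QFT.interpError_nonneg K)⟩
  · subst hK1
    refine ⟨QFT.lebesgueConst_one, hgeom.trans_eq ?_⟩
    rw [QFT.lebesgueConst_one, ← hcast]
    simp
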